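/- Equip $\mathbb R^3$ with $\langle a,b\rangle_E=a_1b_1+a_2b_2+a_3b_3$ (then called $\mathbb E^3$) or $\langle a,b\rangle_L=a_1b_1+a_2b_2-a_3b_3$ (then called $\mathbb L^3$), and with the vector products $a\times_E b=(a_2b_3-b_2a_3,\;a_3b_1-b_3a_1,\;a_1b_2-b_1a_2)$ and $a\times_L b=(a_2b_3-b_2a_3,\;a_3b_1-b_3a_1,\;-(a_1b_2-b_1a_2))$, respectively. All manifolds and maps are smooth. The Hodge star of an oriented Riemannian or Lorentzian surface $(M,g)$ is $*\alpha=\mathrm{vol}_g(\alpha^\sharp,\cdot)$ on 1-forms; thus for a positively oriented orthonormal coframe $*\omega^1=\omega^2$, $*\omega^2=-\omega^1$ if $g=(\omega^1)^2+(\omega^2)^2$, and $*\omega^1=\omega^2$, $*\omega^2=\omega^1$ if $g=(\omega^1)^2-(\omega^2)^2$. Consider an immersion $x$ of an oriented surface that is (i) an immersion into $\mathbb E^3$, (ii) a spacelike immersion into $\mathbb L^3$, or (iii) a timelike immersion into $\mathbb L^3$. Its Gauss map is $\mathbf n=e_1\times_E e_2$ in case (i) and $\mathbf n=-e_1\times_L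 e_2$ in cases (ii), (iii), where $(e_1,e_2)$ is a positively oriented orthonormal tangent frame (in case (iii) with $\langle e_1,e_1\rangle_L=1$, $\langle e_2,e_2\rangle_L=-1$). Its mean curvature with respect to a unit normal field $\mathbf n$ is half the trace, with respect to the induced metric, of the second fundamental form $h(v,w)=-\langle dx(v),d\mathbf n(w)\rangle$. The symbols $\langle\,,\rangle$ and $\times$ refer to $\mathbb E^3$ in case (i) and to $\mathbb L^3$ in cases (ii), (iii). (a) Let $M$ be a connected oriented surface and let $x$ be an immersion of $M$ as in (i), (ii) or (iii), with Gauss map $\mathbf n$ and nowhere vanishing mean curvature $H$ (with respect to $\mathbf n$). Then $$x=-\int\frac1{2H}\{d\mathbf n+\mathbf n\times(*d\mathbf n)\},$$ where $*$ is the Hodge star of the induced metric; that is, $dx=-\frac1{2H}\{d\mathbf n+\mathbf n\times(*d\mathbf n)\}$, and the increments of $x$ are the line integrals of this 1-form along $C^1$ curves in $M$. (b) Conversely, let $M$ be a simply connected oriented surface with a metric $g$ which is Riemannian in cases (i), (ii) and Lorentzian in case (iii), let $H\colon M\to\mathbb R$ be a nowhere vanishing function and let $\mathbf n\colon M\to\mathbb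 R^3$ satisfy $\langle\mathbf n,\mathbf n\rangle_E=1$ in case (i), $\langle\mathbf n,\mathbf n\rangle_L=-1$ in case (ii), $\langle\mathbf n,\mathbf n\rangle_L=1$ in case (iii). Put $\varphi=d\mathbf n+\mathbf n\times(*d\mathbf n)$, with $*$ the Hodge star of $g$, and suppose that $d(\varphi/H)=0$. Then there is a map $x\colon M\to\mathbb R^3$ with $x=-\int\frac1{2H}\varphi$. If moreover $\varphi$ is non-degenerate, in the sense that $\varphi_p\neq0$ for every $p\in M$ in cases (i), (ii), and that $\varphi_p\colon T_pM\to\mathbb R^3$ is injective for every $p\in M$ in case (iii), then every such $x$ is an immersion into $\mathbb E^3$ in case (i), a spacelike immersion into $\mathbb L^3$ in case (ii), a timelike immersion into $\mathbb L^3$ in case (iii); its Gauss map is $\mathbf n$ (in case (iii), for the given orientation of $M$ or for the opposite one), and its mean curvature with respect to $\mathbf n$ is $H$. -/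

import Mathlib

open scoped Manifold ContDiff Topology

noncomputable section

namespace Kenmotsu

/-- The model plane of a surface. -/
abbrev Plane : Type := EuclideanSpace ℝ (Fin 2)

/-- The vector space `ℝ³` underlying both `E³` and `L³`. -/
abbrev R3 : Type := Fin 3 → ℝ

/-- The three situations: surfaces in `E³`, spacelike surfaces in `L³`, timelike surfaces in `L³`. -/
inductive SurfaceType
  | euclidean
  | spacelike
  | timelike

namespace SurfaceType

/-- The sign of the third coordinate in the ambient scalar product and vector product. -/
def ambientSign : SurfaceType → ℝ
  | euclidean => 1
  | spacelike => -1
  | timelike => -1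

/-- The value of `⟨n, n⟩` for the unit normal vector: `n` lies in `S²`, `H²`, `S²₁`. -/
def normalSign : SurfaceType → ℝ
  | euclidean => 1
  | spacelike => -1
  | timelike => 1

/-- The value of `⟨e₂, e₂⟩` for an adapted orthonormal tangent frame `(e₁, e₂)`
(always `⟨e₁, e₁⟩ = 1`). -/
def frameSign : SurfaceType → ℝ
  | euclidean => 1
  | spacelike => 1
  | timelike => -1

/-- The sign in `n = ± e₁ × e₂`: `n = e₁ ×_E e₂` in `E³`, `n = - e₁ ×_L e₂` in `L³`. -/
def gaussSign : SurfaceType → ℝ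
  | euclidean => 1
  | spacelike => -1
  | timelike => -1

/-- The ambient scalar product: `a₁b₁ + a₂b₂ + a₃b₃` in `E³`, `a₁b₁ + a₂b₂ - a₃b₃` in `L³`. -/
def ip (c : SurfaceType) (a b : R3) : ℝ :=
  a 0 * b 0 + a 1 * b 1 + c.ambientSign * (a 2 * b 2)

/-- The ambient vector product `a × ·` (Euclidean or Lorentzian), as a linear map. -/
def cross (c : SurfaceType) (a : R3) : R3 →ₗ[ℝ] R3 where
  toFun b := ![a 1 * b 2 - b 1 * a 2, a 2 * b 0 - b 2 * a 0,
    c.ambientSign * (a 0 * b 1 - b 0 * a 1)]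
  map_add' b b' := by
    ext i; fin_cases i <;> simp <;> ring
  map_smul' r b := by
    ext i; fin_cases i <;> simp <;> ring

/-- The ambient scalar product as a bilinear form. -/
def ipForm (c : SurfaceType) : R3 →ₗ[ℝ] R3 →ₗ[ℝ] ℝ :=
  LinearMap.mk₂ ℝ c.ip
    (fun a a' b => by simp [ip]; ring)
    (fun r a b => by simp [ip]; ring)
    (fun a b b' => by simp [ip]; ring)
    (fun r a b => by simp [ip]; ring)

end SurfaceType

/-- The oriented area of the parallelogram spanned by two vectors of the model plane. -/
def planeDet (v w : Plane) : ℝ := v 0 * w 1 - v 1 * w 0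

section Surface

variable {M : Type*} [TopologicalSpace M] [ChartedSpace Plane M]

/-- The `i`-th vector of the coordinate basis of `T_pM` given by the preferred chart at `p`. -/
def coordVec (p : M) (i : Fin 2) : TangentSpace (𝓡 2) p :=
  (EuclideanSpace.single i 1 : Plane)

variable (M) in
/-- An orientation of the surface `M`: a choice of orientation of every tangent plane, continuous in
the point. `sign p` is `1` if the coordinate basis of `T_pM` given by the preferred chart at `p` is
positively oriented, and `-1` otherwise. -/
structure SurfaceOrientation [IsManifold (𝓡 2) ∞ M] where
  sign : M → ℤˣ
  continuous' : ∀ p : M, ∀ᶠ q in 𝓝 p,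
    0 < ((sign p : ℤ) : ℝ) * ((sign q : ℤ) : ℝ) *
      LinearMap.det (tangentCoordChange (𝓡 2) q p q : Plane →ₗ[ℝ] Plane)

/-- The opposite orientation. -/
instance [IsManifold (𝓡 2) ∞ M] : Neg (SurfaceOrientation M) where
  neg o :=
    { sign := fun p => -o.sign p
      continuous' := fun p => (o.continuous' p).mono fun q hq => by simpa using hq }

/-- `(v, w)` is a positively oriented basis of `T_pM`. -/
def SurfaceOrientation.IsPositive [IsManifold (𝓡 2) ∞ M] (o : SurfaceOrientation M) (p : M)
    (v w : TangentSpace (𝓡 2) p) : Prop :=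
  0 < ((o.sign p : ℤ) : ℝ) * planeDet v w

variable (M) in
/-- `ℝ³`-valued differential 1-forms on `M` (no regularity required). -/
abbrev OneForm : Type _ := (p : M) → (TangentSpace (𝓡 2) p →L[ℝ] R3)

variable (M) in
/-- Fields of bilinear forms on the tangent planes of `M` (no regularity required). -/
abbrev BilinField : Type _ :=
  (p : M) → (TangentSpace (𝓡 2) p →ₗ[ℝ] TangentSpace (𝓡 2) p →ₗ[ℝ] ℝ)

/-- The differential of an `ℝ³`-valued function, as an `ℝ³`-valued 1-form. -/
def diff (f : M → R3) : OneForm M := fun p => mfderiv (𝓡 2) 𝓘(ℝ, R3) f p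

/-- The matrix of a bilinear form in the coordinate basis of `T_pM`. -/
def gram (g : BilinField M) (p : M) : Matrix (Fin 2) (Fin 2) ℝ :=
  Matrix.of fun i j => g p (coordVec p i) (coordVec p j)

/-- The components `α^i = ∑ j, g^{ij} α_j` of the 1-form `α` with the index raised by `g`. -/
def raise (g : BilinField M) (α : OneForm M) (p : M) (i : Fin 2) : R3 :=
  ∑ j, ((gram g p)⁻¹ i j) • α p (coordVec p j)

/-- The coefficient `± √|det g|` of the volume form of `g` in the coordinate basis of `T_pM`. -/
def volCoeff [IsManifold (𝓡 2) ∞ M] (g : BilinField M) (o : SurfaceOrientation M) (p : M) : ℝ :=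
  ((o.sign p : ℤ) : ℝ) * Real.sqrt |(gram g p).det|

/-- The Hodge star on 1-forms of a (Riemannian or Lorentzian) metric `g` on an oriented surface:
`*α = vol_g(α^♯, ·)`. Equivalently `β ∧ *α = g(β, α) vol_g`. For a positively oriented orthonormal
coframe, `*ω¹ = ω²` and `*ω² = -ω¹` if `g` is Riemannian, `*ω¹ = ω²` and `*ω² = ω¹` if
`g = (ω¹)² - (ω²)²`. -/
def hodgeStar [IsManifold (𝓡 2) ∞ M] (g : BilinField M) (o : SurfaceOrientation M)
    (α : OneForm M) : OneForm M := fun p =>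
  volCoeff g o p •
    ((EuclideanSpace.proj 1 : Plane →L[ℝ] ℝ).smulRight (raise g α p 0) -
      (EuclideanSpace.proj 0 : Plane →L[ℝ] ℝ).smulRight (raise g α p 1))

/-- The `ℝ³`-valued 1-form `dn + n × (*dn)`. -/
def kenmotsuForm [IsManifold (𝓡 2) ∞ M] (c : SurfaceType) (g : BilinField M)
    (o : SurfaceOrientation M) (n : M → R3) : OneForm M := fun p =>
  diff n p + (LinearMap.toContinuousLinearMap (c.cross (n p))).comp (hodgeStar g o (diff n) p)

/-- The metric (first fundamental form) induced on `M` by a map `x` to `E³` or `L³`. -/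
def inducedMetric (c : SurfaceType) (x : M → R3) : BilinField M := fun p =>
  c.ipForm.compl₁₂ (diff x p).toLinearMap (diff x p).toLinearMap

/-- A bilinear form on `T_pM` is positive definite. -/
def PosDefAt (g : BilinField M) (p : M) : Prop := ∀ v : TangentSpace (𝓡 2) p, v ≠ 0 → 0 < g p v v

/-- A symmetric bilinear form on the plane `T_pM` has signature `(+, -)`. -/
def LorentzAt (g : BilinField M) (p : M) : Prop :=
  (∃ v : TangentSpace (𝓡 2) p, 0 < g p v v) ∧ ∃ w : TangentSpace (𝓡 2) p, g p w w < 0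

/-- `x` is a smooth immersion into `E³`, a smooth spacelike immersion into `L³`, or a smooth timelike
immersion into `L³`, respectively. -/
def IsSurface (c : SurfaceType) (x : M → R3) : Prop :=
  ContMDiff (𝓡 2) 𝓘(ℝ, R3) ∞ x ∧ (∀ p, Function.Injective (diff x p)) ∧
    match c with
    | .euclidean => True
    | .spacelike => ∀ p, PosDefAt (inducedMetric c x) p
    | .timelike => ∀ p, LorentzAt (inducedMetric c x) p

/-- `(e₁, e₂)` is an orthonormal basis of `T_pM` for the metric induced by `x`, with `e₁` spacelike
and `e₂` timelike in the case of a timelike surface. -/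
def IsFrame (c : SurfaceType) (x : M → R3) (p : M) (e₁ e₂ : TangentSpace (𝓡 2) p) : Prop :=
  inducedMetric c x p e₁ e₁ = 1 ∧ inducedMetric c x p e₂ e₂ = c.frameSign ∧
    inducedMetric c x p e₁ e₂ = 0

/-- `n` is the Gauss map of the oriented surface `x`: for every positively oriented orthonormal
frame, `n = e₁ ×_E e₂` in `E³` and `n = - e₁ ×_L e₂` in `L³` (tangent vectors being identified with
their images under `dx`). -/
def IsGaussMap [IsManifold (𝓡 2) ∞ M] (c : SurfaceType) (o : SurfaceOrientation M)
    (x n : M → R3) : Prop :=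
  ∀ (p : M) (e₁ e₂ : TangentSpace (𝓡 2) p), IsFrame c x p e₁ e₂ → o.IsPositive p e₁ e₂ →
    n p = c.gaussSign • c.cross (diff x p e₁) (diff x p e₂)

/-- The second fundamental form `h(v, w) = -⟨dx(v), dn(w)⟩` of the surface `x` with respect to the
unit normal field `n`. -/
def secondForm (c : SurfaceType) (x n : M → R3) (p : M) (v w : TangentSpace (𝓡 2) p) : ℝ :=
  -c.ip (diff x p v) (diff n p w)

/-- `H` is the mean curvature function of the surface `x` with respect to the unit normal field `n`:
half of the trace of the second fundamental form with respect to the induced metric, that is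
`H = (h₁₁ + h₂₂) / 2` for spacelike and `H = (h₁₁ - h₂₂) / 2` for timelike surfaces, in orthonormal
frames. -/
def IsMeanCurvature (c : SurfaceType) (x n : M → R3) (H : M → ℝ) : Prop :=
  ∀ (p : M) (e₁ e₂ : TangentSpace (𝓡 2) p), IsFrame c x p e₁ e₂ →
    H p = (secondForm c x n p e₁ e₁ + c.frameSign * secondForm c x n p e₂ e₂) / 2

/-- `x = ∫ η`: the differential of `x` is `η`, and the increments of `x` are the line integrals of
`η` along `C¹` curves in `M`. -/
def IsIntegralOf (x : M → R3) (η : OneForm M) : Prop :=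
  (∀ p, HasMFDerivAt (𝓡 2) 𝓘(ℝ, R3) x p (η p)) ∧
  ∀ γ : ℝ → M, ContMDiff 𝓘(ℝ, ℝ) (𝓡 2) 1 γ → ∀ a b : ℝ,
    IntervalIntegrable (fun t => η (γ t) (mfderiv 𝓘(ℝ, ℝ) (𝓡 2) γ t (1 : ℝ)))
      MeasureTheory.volume a b ∧
    x (γ b) - x (γ a) = ∫ t in a..b, η (γ t) (mfderiv 𝓘(ℝ, ℝ) (𝓡 2) γ t (1 : ℝ))

/-- The differential at `y` of the inverse of the preferred chart at `p₀`: it sends the standard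
basis to the coordinate vector fields of that chart. -/
def chartFrame (p₀ : M) (y : Plane) :
    Plane →L[ℝ] TangentSpace (𝓡 2) ((extChartAt (𝓡 2) p₀).symm y) :=
  mfderiv 𝓘(ℝ, Plane) (𝓡 2) (extChartAt (𝓡 2) p₀).symm y

/-- The expression of a 1-form in the preferred chart at `p₀`, as an alternating form on the
plane. -/
def formInChart (η : OneForm M) (p₀ : M) (y : Plane) : Plane [⋀^Fin 1]→L[ℝ] R3 :=
  ContinuousAlternatingMap.ofSubsingleton ℝ Plane R3 0
    ((η ((extChartAt (𝓡 2) p₀).symm y)).comp (chartFrame p₀ y))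

/-- `dη = 0`, the exterior derivative being computed in charts. -/
def IsClosedForm (η : OneForm M) : Prop :=
  ∀ p₀ : M, ∀ y ∈ (extChartAt (𝓡 2) p₀).target, extDeriv (formInChart η p₀) y = 0

/-- `g` is a smooth metric on `M`: Riemannian in the first two situations, Lorentzian in the
third. -/
def IsMetric (c : SurfaceType) (g : BilinField M) : Prop :=
  (∀ p (v w : TangentSpace (𝓡 2) p), g p v w = g p w v) ∧
  (∀ (p₀ : M) (u v : Plane), ContDiffOn ℝ ∞
    (fun y => g ((extChartAt (𝓡 2) p₀).symm y) (chartFrame p₀ y u) (chartFrame p₀ y v))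
    (extChartAt (𝓡 2) p₀).target) ∧
  match c with
  | .euclidean => ∀ p, PosDefAt g p
  | .spacelike => ∀ p, PosDefAt g p
  | .timelike => ∀ p, LorentzAt g p

/-- The non-degeneracy condition on a 1-form: it vanishes at no point; in the timelike case, where
a non-zero value may have rank one, it is injective at every point. -/
def IsNondegenerate (c : SurfaceType) (η : OneForm M) : Prop :=
  match c with
  | .euclidean => ∀ p, η p ≠ 0
  | .spacelike => ∀ p, η p ≠ 0
  | .timelike => ∀ p, Function.Injective (η p)

end Surface

end Kenmotsu

end

open scoped Manifold ContDiff Topology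

noncomputable section

namespace Kenmotsu

/-! ### Algebra of the ambient space -/

namespace SurfaceType

/-! On one tangent plane write A = dn, T = dx, ε = `frameSign`, and let J = n × · on the plane
orthogonal to n. There J² = -ε, so J is a complex (ε = 1) or para-complex (ε = -1) structure, and J
is skew for the ambient product. In a positive adapted frame *A takes e₁ to -ε A(e₂) and e₂ to
A(e₁). Hence Φ = A + n × *A is, up to a factor 2, the part of A that intertwines the rotation e₁ ↦
e₂ ↦ -ε e₁ with J.

Direct part: A is minus the shape operator, which is symmetric. Its trace-free part anticommutes
with J and drops out of Φ; the trace remains and gives Φ = -2H T (`representation_at`). Symmetry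
comes from the symmetry of second derivatives (`IsGaussMap.secondForm_symm`), and smoothness of n
from a formula in coordinates (`IsGaussMap.contMDiff`).

Converse: Φ is orthogonal to n and Φ(e₂) = n × Φ(e₁), so ⟨Φ v, Φ w⟩ = l g(v, w) for some number l at
each point (`exists_conformal_factor`). Non-degeneracy gives l > 0 for Riemannian g and l ≠ 0 for
Lorentzian g. If l < 0, spacelike and timelike directions trade places and n is the Gauss map for
the opposite orientation; connectedness keeps the sign of l constant (`factor_sign`). For dx =
-(1/2H) Φ, skewness of J turns the trace of ⟨dx, dn⟩ into ⟨dx(e₁), Φ(e₁)⟩ = -2H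
(`exists_sign_of_frame`). The map x itself comes from the Poincaré lemma in charts, glued over the
simply connected surface by a covering space argument (`exists_primitive`). -/

theorem frameSign_mul_self (c : SurfaceType) : c.frameSign * c.frameSign = 1 := by
  cases c <;> simp [frameSign]

theorem ambientSign_mul_self (c : SurfaceType) : c.ambientSign * c.ambientSign = 1 := by
  cases c <;> simp [ambientSign]

theorem gaussSign_eq (c : SurfaceType) : c.gaussSign = c.ambientSign := by
  cases c <;> rfl

theorem ambientSign_mul_normalSign (c : SurfaceType) :
    c.ambientSign * c.normalSign = c.frameSign := by
  cases c <;> simp [ambientSign, normalSign, frameSign]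

theorem ambientSign_mul_frameSign (c : SurfaceType) :
    c.ambientSign * c.frameSign = c.normalSign := by
  cases c <;> simp [ambientSign, normalSign, frameSign]

theorem cross_apply (c : SurfaceType) (a b : R3) :
    c.cross a b = ![a 1 * b 2 - b 1 * a 2, a 2 * b 0 - b 2 * a 0,
      c.ambientSign * (a 0 * b 1 - b 0 * a 1)] := rfl

theorem ip_comm (c : SurfaceType) (a b : R3) : c.ip a b = c.ip b a := by
  simp only [ip]; ring

theorem ip_add_left (c : SurfaceType) (a a' b : R3) : c.ip (a + a') b = c.ip a b + c.ip a' b := by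
  simp only [ip, Pi.add_apply]; ring

theorem ip_add_right (c : SurfaceType) (a b b' : R3) : c.ip a (b + b') = c.ip a b + c.ip a b' := by
  simp only [ip, Pi.add_apply]; ring

theorem ip_smul_left (c : SurfaceType) (r : ℝ) (a b : R3) : c.ip (r • a) b = r * c.ip a b := by
  simp only [ip, Pi.smul_apply, smul_eq_mul]; ring

theorem ip_smul_right (c : SurfaceType) (r : ℝ) (a b : R3) : c.ip a (r • b) = r * c.ip a b := by
  simp only [ip, Pi.smul_apply, smul_eq_mul]; ring

theorem cross_smul_left (c : SurfaceType) (r : ℝ) (a b : R3) :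
    c.cross (r • a) b = r • c.cross a b := by
  ext i; fin_cases i <;> (simp [cross_apply]; ring)

theorem cross_anticomm (c : SurfaceType) (a b : R3) : c.cross a b = -c.cross b a := by
  ext i; fin_cases i <;> simp [cross_apply]; ring

/-- The triple product rule, with the ambient sign; most later identities for n × · are instances of
it. -/
theorem cross_cross (c : SurfaceType) (a b w : R3) :
    c.cross a (c.cross b w) = c.ambientSign • (c.ip a w • b - c.ip a b • w) := by
  ext i; cases c <;> fin_cases i <;> simp [cross_apply, ip, ambientSign] <;> ring

theorem ip_cross_left (c : SurfaceType) (n u w : R3) :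
    c.ip (c.cross n u) w = -c.ip u (c.cross n w) := by
  cases c <;> simp [cross_apply, ip, ambientSign] <;> ring

theorem ip_cross_self (c : SurfaceType) (n u : R3) : c.ip (c.cross n u) n = 0 := by
  cases c <;> simp [cross_apply, ip, ambientSign] <;> ring

theorem ip_cross_cross (c : SurfaceType) (u w : R3) :
    c.ip (c.cross u w) (c.cross u w) =
      c.ambientSign * (c.ip u u * c.ip w w - c.ip u w * c.ip u w) := by
  cases c <;> simp [cross_apply, ip, ambientSign] <;> ring

/-- On the orthogonal complement of the unit normal, `n × ·` squares to `-ε`. -/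
theorem cross_cross_normal (c : SurfaceType) {n w : R3} (hn : c.ip n n = c.normalSign)
    (hw : c.ip w n = 0) : c.cross n (c.cross n w) = -c.frameSign • w := by
  rw [cross_cross, ip_comm c n w, hw, hn, zero_smul, zero_sub, smul_neg, smul_smul,
    ambientSign_mul_normalSign, neg_smul]

/-- Skewness together with J² = -ε: an isometry for ε = 1, an anti-isometry exchanging spacelike and
timelike for ε = -1. -/
theorem ip_cross_normal (c : SurfaceType) {n u w : R3} (hn : c.ip n n = c.normalSign)
    (hw : c.ip w n = 0) : c.ip (c.cross n u) (c.cross n w) = c.frameSign * c.ip u w := by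
  rw [ip_cross_left, cross_cross_normal c hn hw, ip_smul_right]; ring

/-- The orthogonal complement of the unit normal of a spacelike plane is positive definite. -/
theorem ip_self_pos {c : SurfaceType} (hc : c.frameSign = 1) {n w : R3}
    (hn : c.ip n n = c.normalSign) (hw : c.ip w n = 0) (h0 : w ≠ 0) : 0 < c.ip w w := by
  have key : ¬(w 0 = 0 ∧ w 1 = 0 ∧ w 2 = 0) := fun h =>
    h0 (by ext i; fin_cases i <;> simp [h])
  cases c
  · by_contra hneg
    simp only [ip, ambientSign, not_lt] at hneg
    apply key
    refine ⟨?_, ?_, ?_⟩ <;> nlinarith [sq_nonneg (w 0), sq_nonneg (w 1), sq_nonneg (w 2)]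
  · simp only [ip, ambientSign, normalSign] at hn hw ⊢
    have h2 : n 2 * n 2 = 1 + n 0 * n 0 + n 1 * n 1 := by linarith
    have h3 : w 2 * n 2 = w 0 * n 0 + w 1 * n 1 := by linarith
    have hn2 : 0 < n 2 * n 2 := by nlinarith [mul_self_nonneg (n 0), mul_self_nonneg (n 1)]
    -- Lagrange's identity for the first two coordinates, after multiplying by (n 2)² and
    -- eliminating (n 2)² and w 2 * n 2 with `h2` and `h3`.
    have e : (n 2 * n 2) * (w 0 * w 0 + w 1 * w 1 + -1 * (w 2 * w 2)) =
        w 0 * w 0 + w 1 * w 1 + (w 0 * n 1 - w 1 * n 0) * (w 0 * n 1 - w 1 * n 0) := by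
      have : (w 2 * n 2) * (w 2 * n 2) = (w 0 * n 0 + w 1 * n 1) * (w 0 * n 0 + w 1 * n 1) := by
        rw [h3]
      linear_combination (w 0 * w 0 + w 1 * w 1) * h2 - this
    have h4 : 0 < w 0 * w 0 + w 1 * w 1 := by
      by_contra hneg
      have h00 : w 0 = 0 := by nlinarith [mul_self_nonneg (w 0), mul_self_nonneg (w 1)]
      have h11 : w 1 = 0 := by nlinarith [mul_self_nonneg (w 0), mul_self_nonneg (w 1)]
      refine key ⟨h00, h11, ?_⟩
      rw [h00, h11] at h3
      have : n 2 ≠ 0 := fun h => by simp [h] at hn2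
      simpa [this] using h3
    have h5 := mul_self_nonneg (w 0 * n 1 - w 1 * n 0)
    by_contra hneg
    nlinarith
  · norm_num [frameSign] at hc

/-- A vanishing vector product means linear dependence. -/
theorem smul_eq_smul_of_cross_eq_zero (c : SurfaceType) {a b : R3} (h : c.cross a b = 0)
    (i : Fin 3) : a i • b = b i • a := by
  have h0 := congrFun h 0
  have h1 := congrFun h 1
  have h2 : c.ambientSign * (a 0 * b 1 - b 0 * a 1) = 0 := congrFun h 2
  have ha : c.ambientSign ≠ 0 := by cases c <;> simp [ambientSign]
  simp only [cross_apply, Pi.zero_apply, Matrix.cons_val_zero, Matrix.cons_val_one] at h0 h1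
  rw [mul_eq_zero, or_iff_right ha] at h2
  ext j
  fin_cases i <;> fin_cases j <;> simp <;> linarith

/-- An orthonormal frame `(X₁, X₂)` with unit normal `n = ± X₁ × X₂`: `n ⟂ X₁`, `n × X₁ = X₂`. -/
theorem frame_relations (c : SurfaceType) {n X Y : R3} (hX : c.ip X X = 1)
    (hY : c.ip Y Y = c.frameSign) (hXY : c.ip X Y = 0)
    (hn : n = c.gaussSign • c.cross X Y) :
    c.ip n n = c.normalSign ∧ c.ip X n = 0 ∧ c.ip Y n = 0 ∧ c.cross n X = Y ∧
      c.cross n Y = -c.frameSign • X := by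
  rw [gaussSign_eq] at hn
  subst hn
  refine ⟨?_, ?_, ?_, ?_, ?_⟩
  · rw [ip_smul_left, ip_smul_right, ip_cross_cross, hX, hY, hXY, ← ambientSign_mul_frameSign]
    linear_combination c.ambientSign * c.frameSign * c.ambientSign_mul_self
  · rw [ip_smul_right, ip_comm, ip_cross_self, mul_zero]
  · rw [ip_smul_right, ip_comm, cross_anticomm, ← neg_one_smul ℝ, ip_smul_left, ip_cross_self]
    ring
  · rw [cross_smul_left, cross_anticomm, cross_cross, hX, hXY, zero_smul, zero_sub, one_smul]
    simp [smul_smul, ambientSign_mul_self]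
  · rw [cross_smul_left, cross_anticomm, cross_cross, hY, ip_comm, hXY, zero_smul, sub_zero,
      smul_neg, smul_smul, ambientSign_mul_self, one_smul, neg_smul]

/-- If `X` is a unit vector orthogonal to `n`, then `n` is the Gauss map of `(X, n × X)`. -/
theorem eq_gaussSign_smul_cross (c : SurfaceType) {n X : R3} (hX : c.ip X X = 1)
    (hXn : c.ip X n = 0) : n = c.gaussSign • c.cross X (c.cross n X) := by
  rw [cross_cross, hX, hXn, gaussSign_eq, smul_smul, ambientSign_mul_self]
  simp

/-- Expansion of a tangent vector in an orthonormal frame. -/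
theorem eq_frame_expansion (c : SurfaceType) {n X Y w : R3} (hX : c.ip X X = 1)
    (hY : c.ip Y Y = c.frameSign) (hXY : c.ip X Y = 0)
    (hn : n = c.gaussSign • c.cross X Y) (hw : c.ip w n = 0) :
    w = c.ip w X • X + (c.frameSign * c.ip w Y) • Y := by
  obtain ⟨hnn, -, -, h1, h2⟩ := c.frame_relations hX hY hXY hn
  -- The triple product with n = ± X × Y gives n × w in terms of X and Y; a second n × · then
  -- recovers w, since J² = -ε is invertible.
  have e1 : c.cross n w = c.ip w X • Y - c.ip w Y • X := by
    conv_lhs => rw [hn, gaussSign_eq, cross_smul_left, cross_anticomm, cross_cross]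
    rw [smul_neg, smul_smul, ambientSign_mul_self, one_smul, neg_sub]
  have e2 := c.cross_cross_normal hnn hw
  rw [e1, map_sub, map_smul, map_smul, h1, h2] at e2
  have e3 := congrArg (fun z => -c.frameSign • z) e2
  simp only [smul_smul, smul_sub] at e3
  rw [show -c.frameSign * -c.frameSign = 1 by linear_combination c.frameSign_mul_self,
    one_smul] at e3
  have hε := c.frameSign_mul_self
  rw [show -c.frameSign * (c.ip w X * -c.frameSign) = c.ip w X by
    linear_combination c.ip w X * hε] at e3
  exact e3.symm.trans (by module)

end SurfaceType

/-! ### Algebra of the tangent plane -/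

/-- Bilinear forms on the model plane. -/
abbrev PlaneForm : Type := Plane →ₗ[ℝ] Plane →ₗ[ℝ] ℝ

/-- The first vector of the standard basis. -/
def E₀ : Plane := EuclideanSpace.single 0 1

/-- The second vector of the standard basis. -/
def E₁ : Plane := EuclideanSpace.single 1 1

theorem plane_eq (v : Plane) : v = v 0 • E₀ + v 1 • E₁ := by
  ext i; fin_cases i <;> simp [E₀, E₁]

/-- Cramer's rule. -/
theorem planeDet_smul_eq (u w v : Plane) :
    planeDet u w • v = planeDet v w • u + planeDet u v • w := by
  ext i; fin_cases i <;> simp [planeDet] <;> ring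

/-- The Gram determinant of two vectors. -/
def gramDet (G : PlaneForm) (u w : Plane) : ℝ := G u u * G w w - G u w * G u w

theorem form_expand (G : PlaneForm) (u w : Plane) :
    G u w = u 0 * w 0 * G E₀ E₀ + u 0 * w 1 * G E₀ E₁ + u 1 * w 0 * G E₁ E₀ +
      u 1 * w 1 * G E₁ E₁ := by
  conv_lhs => rw [plane_eq u, plane_eq w]
  simp only [map_add, map_smul, LinearMap.add_apply, LinearMap.smul_apply, smul_eq_mul]
  ring

/-- Change of basis multiplies the Gram determinant by a square, so its sign depends only on the
signature. -/
theorem gramDet_eq {G : PlaneForm} (hG : ∀ v w, G v w = G w v) (u w : Plane) :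
    gramDet G u w = planeDet u w ^ 2 * gramDet G E₀ E₁ := by
  simp only [gramDet, planeDet]
  rw [form_expand G u u, form_expand G w w, form_expand G u w, hG E₁ E₀]
  ring

/-- The model of the Hodge star on a single tangent plane. -/
def starAt (G : PlaneForm) (s : ℝ) (α : Plane →L[ℝ] R3) (v : Plane) : R3 :=
  (s * Real.sqrt |gramDet G E₀ E₁| / gramDet G E₀ E₁) •
    (G v E₁ • α E₀ - G v E₀ • α E₁)

/-- The Hodge star computed in an arbitrary basis. -/
theorem starAt_eq {G : PlaneForm} (hG : ∀ v w, G v w = G w v) (s : ℝ) (α : Plane →L[ℝ] R3)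
    {u w : Plane} (hd : planeDet u w ≠ 0) (v : Plane) :
    starAt G s α v = (s * (planeDet u w / |planeDet u w|) * Real.sqrt |gramDet G u w| /
      gramDet G u w) • (G v w • α u - G v u • α w) := by
  -- The expression is alternating in (u, w), hence scales by `planeDet u w`. The factor √|D| / D
  -- scales by |d| / d², so that only the sign d / |d| survives.
  have h1 : G v w • α u - G v u • α w = planeDet u w • (G v E₁ • α E₀ - G v E₀ • α E₁) := by
    conv_lhs => rw [plane_eq u, plane_eq w]
    simp only [map_add, map_smul, smul_eq_mul, planeDet]
    module
  rw [starAt, h1, smul_smul, gramDet_eq hG u w, abs_mul, Real.sqrt_mul (abs_nonneg _),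
    abs_pow, Real.sqrt_sq (abs_nonneg _)]
  congr 1
  have := abs_ne_zero.2 hd
  by_cases h0 : gramDet G E₀ E₁ = 0
  · simp [h0]
  · field_simp

/-- The Hodge star in a frame that is orthogonal with `G(u,u) = κ`, `G(w,w) = ε κ`. -/
theorem exists_starAt_conformal {G : PlaneForm} (hG : ∀ v w, G v w = G w v) {s κ ε : ℝ}
    (hs : s * s = 1) (hε : ε * ε = 1) (hκ : κ ≠ 0) {u w : Plane} (huu : G u u = κ)
    (hww : G w w = ε * κ) (huw : G u w = 0) :
    ∃ σ : ℝ, σ * σ = 1 ∧ (0 < s * planeDet u w * κ → σ = 1) ∧ ∀ α : Plane →L[ℝ] R3,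
      starAt G s α u = -(ε * σ) • α w ∧ starAt G s α w = σ • α u := by
  have hD : gramDet G u w = ε * κ ^ 2 := by rw [gramDet, huu, hww, huw]; ring
  have hε0 : ε ≠ 0 := by rintro rfl; simp at hε
  have hd : planeDet u w ≠ 0 := by
    intro h
    rw [gramDet_eq hG, h] at hD
    have : ε * κ ^ 2 ≠ 0 := by positivity
    exact this (by rw [← hD]; ring)
  have hsq : Real.sqrt |gramDet G u w| = |κ| := by
    have : |ε| = 1 := by
      rcases mul_self_eq_one_iff.1 hε with h | h <;> simp [h]
    rw [hD, abs_mul, this, one_mul, abs_pow, Real.sqrt_sq (abs_nonneg _)]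
  have hda := abs_ne_zero.2 hd
  have hka := abs_ne_zero.2 hκ
  -- σ is the orientation sign of (u, w) times the sign of κ. The latter appears because √|D| = |κ|
  -- while the surviving coefficients are κ and εκ; κ < 0 means that u is timelike.
  refine ⟨s * (planeDet u w / |planeDet u w|) * (κ / |κ|), ?_, ?_, fun α => ⟨?_, ?_⟩⟩
  · have h1 : planeDet u w / |planeDet u w| * (planeDet u w / |planeDet u w|) = 1 := by
      rw [div_mul_div_comm, abs_mul_abs_self, div_self (mul_ne_zero hd hd)]
    have h2 : κ / |κ| * (κ / |κ|) = 1 := by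
      rw [div_mul_div_comm, abs_mul_abs_self, div_self (mul_ne_zero hκ hκ)]
    linear_combination (planeDet u w / |planeDet u w|) ^ 2 * (κ / |κ|) ^ 2 * hs +
      (κ / |κ|) ^ 2 * h1 + h2
  · intro hpos
    have hs1 : |s| = 1 := by rcases mul_self_eq_one_iff.1 hs with h | h <;> simp [h]
    have := abs_of_pos hpos
    rw [abs_mul, abs_mul, hs1, one_mul] at this
    field_simp
    rw [this]
  · rw [starAt_eq hG s α hd, hsq, hD, huw, huu, zero_smul, zero_sub, smul_neg, smul_smul,
      ← neg_smul]
    congr 2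
    have : |κ| * |κ| = κ * κ := abs_mul_abs_self κ
    field_simp
    linear_combination s * this - s * κ ^ 2 * hε
  · rw [starAt_eq hG s α hd, hsq, hD, hww, hG w u, huw, zero_smul, sub_zero, smul_smul]
    congr 1
    have : |κ| * |κ| = κ * κ := abs_mul_abs_self κ
    field_simp
    linear_combination s * this

/-- Existence of positively oriented orthonormal frames. -/
theorem exists_frame {G : PlaneForm} (hG : ∀ v w, G v w = G w v) {s ε : ℝ} (hs : s * s = 1)
    (hε : ε * ε = 1) (hpos : ∃ v, 0 < G v v) (hdet : 0 < ε * gramDet G E₀ E₁) :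
    ∃ u w : Plane, G u u = 1 ∧ G w w = ε ∧ G u w = 0 ∧ 0 < s * planeDet u w := by
  obtain ⟨v, hv⟩ := hpos
  -- The covector G v · turned by a right angle: it makes G v z = 0 and `planeDet v z` = G v v > 0.
  set z : Plane := G v E₀ • E₁ - G v E₁ • E₀ with hz
  have hvz : G v z = 0 := by simp [hz]; ring
  have hdz : planeDet v z = G v v := by
    have h1 : G v v = v 0 * G v E₀ + v 1 * G v E₁ := by
      conv_lhs => rw [show G v v = G v (v 0 • E₀ + v 1 • E₁) by rw [← plane_eq]]
      simp
    rw [h1]; simp [planeDet, hz, E₀, E₁]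
  have hzz : G z z = G v v * gramDet G E₀ E₁ := by
    have := gramDet_eq hG v z
    rw [hdz, gramDet, hvz] at this
    have h2 : G v v * G z z = G v v * (G v v * gramDet G E₀ E₁) := by linear_combination this
    exact mul_left_cancel₀ hv.ne' h2
  have hεz : 0 < ε * G z z := by
    rw [hzz]; nlinarith [mul_pos hv hdet]
  set a := Real.sqrt (G v v) with ha
  set b := Real.sqrt (ε * G z z) with hb
  have ha0 : 0 < a := Real.sqrt_pos.2 hv
  have hb0 : 0 < b := Real.sqrt_pos.2 hεz
  have haa : a * a = G v v := Real.mul_self_sqrt hv.le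
  have hbb : b * b = ε * G z z := Real.mul_self_sqrt hεz.le
  -- The factor s = ±1 leaves the norm unchanged and makes the frame positive.
  refine ⟨a⁻¹ • v, (s * b⁻¹) • z, ?_, ?_, ?_, ?_⟩
  · simp only [map_smul, LinearMap.smul_apply, smul_eq_mul, ← haa]; field_simp
  · have : G z z = ε * (b * b) := by rw [hbb]; linear_combination -G z z * hε
    simp only [map_smul, LinearMap.smul_apply, smul_eq_mul, this]
    field_simp
    linear_combination ε * hs
  · simp [hvz]
  · have : planeDet (a⁻¹ • v) ((s * b⁻¹) • z) = s * (a⁻¹ * b⁻¹ * planeDet v z) := by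
      simp [planeDet]; ring
    rw [this, hdz, ← mul_assoc, hs, one_mul]
    positivity

theorem gramDet_pos_of_posDef {G : PlaneForm} (hG : ∀ v w, G v w = G w v)
    (h : ∀ v, v ≠ 0 → 0 < G v v) : 0 < gramDet G E₀ E₁ := by
  have h0 : E₀ ≠ 0 := fun h => by simpa [E₀] using congrArg (fun v : Plane => v 0) h
  have h00 := h _ h0
  -- Unnormalised Gram–Schmidt: G z z is G E₀ E₀ times the Gram determinant.
  set z : Plane := G E₀ E₀ • E₁ - G E₀ E₁ • E₀ with hz
  have hz0 : z ≠ 0 := fun h => by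
    have := congrArg (fun v : Plane => v 1) h
    simp [hz, E₀, E₁] at this
    exact h00.ne' (by simpa [E₀] using this)
  have hzz : G z z = G E₀ E₀ * gramDet G E₀ E₁ := by
    simp only [hz, gramDet, hG E₁ E₀, map_sub, map_smul, LinearMap.sub_apply,
      LinearMap.smul_apply, smul_eq_mul]
    ring
  exact pos_of_mul_pos_right (hzz ▸ h z hz0) h00.le

/-- By `gramDet_eq` it is enough to see the sign on the pair (v, w), where both terms of the Gram
determinant push it below zero. -/
theorem gramDet_neg_of_lorentz {G : PlaneForm} (hG : ∀ v w, G v w = G w v) {v w : Plane}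
    (hv : 0 < G v v) (hw : G w w < 0) : gramDet G E₀ E₁ < 0 := by
  have h := gramDet_eq hG v w
  have h1 : gramDet G v w < 0 := by
    rw [gramDet]; nlinarith [mul_pos_of_neg_of_neg hw (neg_neg_of_pos hv), mul_self_nonneg (G v w)]
  rw [h] at h1
  by_contra hneg
  exact absurd h1 (not_lt.2 (mul_nonneg (sq_nonneg _) (not_lt.1 hneg)))

theorem ext_of_planeDet {S T : Plane →L[ℝ] R3} {u w : Plane} (hd : planeDet u w ≠ 0)
    (hu : S u = T u) (hw : S w = T w) : S = T := by
  ext1 v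
  have h : planeDet u w • S v = planeDet u w • T v := by
    rw [← map_smul, ← map_smul, planeDet_smul_eq, map_add, map_add, map_smul, map_smul, map_smul,
      map_smul, hu, hw]
  exact smul_right_injective R3 hd h

/-- Conformality only has to be checked on a basis; Cramer's rule costs a factor `planeDet u w`
squared, cancelled at the end. -/
theorem ip_eq_of_frame {c : SurfaceType} {G : PlaneForm} (hG : ∀ v w, G v w = G w v)
    {Φ : Plane →L[ℝ] R3} {l : ℝ} {u w : Plane} (hd : planeDet u w ≠ 0)
    (huu : c.ip (Φ u) (Φ u) = l * G u u) (hww : c.ip (Φ w) (Φ w) = l * G w w)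
    (huw : c.ip (Φ u) (Φ w) = l * G u w) (v z : Plane) :
    c.ip (Φ v) (Φ z) = l * G v z := by
  have hv := planeDet_smul_eq u w v
  have hz := planeDet_smul_eq u w z
  have e1 : c.ip (Φ (planeDet u w • v)) (Φ (planeDet u w • z)) =
      l * G (planeDet u w • v) (planeDet u w • z) := by
    rw [hv, hz]
    simp only [map_add, map_smul, LinearMap.add_apply, LinearMap.smul_apply, smul_eq_mul,
      c.ip_add_left, c.ip_add_right, c.ip_smul_left, c.ip_smul_right, huu, hww, huw,
      c.ip_comm (Φ w) (Φ u), hG w u]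
    ring
  simp only [map_smul, LinearMap.smul_apply, smul_eq_mul, c.ip_smul_left, c.ip_smul_right] at e1
  have h2 : planeDet u w * planeDet u w ≠ 0 := mul_ne_zero hd hd
  apply mul_left_cancel₀ h2
  linear_combination e1

/-! ### Both directions of the theorem on a single tangent plane. -/

/-- The pointwise form of the representation formula: `dx = -(1/2H) (dn + n × *dn)`. -/
theorem representation_at {c : SurfaceType} {G : PlaneForm} {T A Φ : Plane →L[ℝ] R3} {n : R3}
    {s H : ℝ} {e₁ e₂ : Plane} (hs : s * s = 1) (hGT : ∀ v w, G v w = c.ip (T v) (T w))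
    (h11 : G e₁ e₁ = 1) (h22 : G e₂ e₂ = c.frameSign) (h12 : G e₁ e₂ = 0)
    (hpos : 0 < s * planeDet e₁ e₂) (hn : n = c.gaussSign • c.cross (T e₁) (T e₂))
    (hAn : ∀ v, c.ip (A v) n = 0) (hsymm : ∀ v w, c.ip (T v) (A w) = c.ip (T w) (A v))
    (hH : H = (-c.ip (T e₁) (A e₁) + c.frameSign * -c.ip (T e₂) (A e₂)) / 2) (hH0 : H ≠ 0)
    (hΦ : ∀ v, Φ v = A v + c.cross n (starAt G s A v)) :
    T = -(1 / (2 * H)) • Φ := by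
  have hG : ∀ v w, G v w = G w v := fun v w => by rw [hGT, hGT, c.ip_comm]
  have hε := c.frameSign_mul_self
  have hX : c.ip (T e₁) (T e₁) = 1 := by rw [← hGT, h11]
  have hY : c.ip (T e₂) (T e₂) = c.frameSign := by rw [← hGT, h22]
  have hXY : c.ip (T e₁) (T e₂) = 0 := by rw [← hGT, h12]
  have hd : planeDet e₁ e₂ ≠ 0 := fun h => by simp [h] at hpos
  obtain ⟨σ, -, hσ, hstar⟩ := exists_starAt_conformal hG hs hε one_ne_zero h11
    (by rw [h22, mul_one]) h12
  rw [mul_one] at hσ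
  obtain ⟨hst1, hst2⟩ := hstar A
  rw [hσ hpos] at hst1 hst2
  obtain ⟨-, -, -, hJX, hJY⟩ := c.frame_relations hX hY hXY hn
  have a1 := c.eq_frame_expansion hX hY hXY hn (hAn e₁)
  have a2 := c.eq_frame_expansion hX hY hXY hn (hAn e₂)
  have hs12 : c.ip (A e₁) (T e₂) = c.ip (A e₂) (T e₁) := by
    rw [c.ip_comm, hsymm, c.ip_comm]
  rw [c.ip_comm (T e₁), c.ip_comm (T e₂)] at hH
  rw [hs12] at a1
  generalize c.ip (A e₁) (T e₁) = a at *
  generalize c.ip (A e₂) (T e₁) = b at *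
  generalize c.ip (A e₂) (T e₂) = d at *
  -- By symmetry of the second form, A e₁ = a X + ε b Y and A e₂ = b X + ε d Y with X = T e₁, Y = T
  -- e₂. In Φ the terms in b cancel and the diagonal ones add up to a + ε d = -2H.
  have hΦ1 : Φ e₁ = (-(2 * H)) • T e₁ := by
    rw [hΦ, hst1, a1, a2]
    simp only [map_add, map_smul, hJX, hJY, smul_add, smul_smul]
    have h1 : -(2 * H) = a + c.frameSign * d := by rw [hH]; ring
    rw [h1]
    rw [show -(c.frameSign * 1) * (c.frameSign * d) * -c.frameSign = c.frameSign * d by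
      linear_combination c.frameSign * d * hε]
    module
  have hΦ2 : Φ e₂ = (-(2 * H)) • T e₂ := by
    rw [hΦ, hst2, a1, a2]
    simp only [map_add, map_smul, hJX, hJY, smul_add, smul_smul]
    have h1 : -(2 * H) = a + c.frameSign * d := by rw [hH]; ring
    rw [h1]
    rw [show 1 * (c.frameSign * b) * -c.frameSign = -b by linear_combination -b * hε]
    module
  have h2H : (2 * H) ≠ 0 := mul_ne_zero two_ne_zero hH0
  refine ext_of_planeDet hd ?_ ?_
  · rw [smul_apply, hΦ1, smul_smul]
    rw [show -(1 / (2 * H)) * -(2 * H) = 1 by field_simp, one_smul]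
  · rw [smul_apply, hΦ2, smul_smul]
    rw [show -(1 / (2 * H)) * -(2 * H) = 1 by field_simp, one_smul]

/-- The form `dn + n × *dn` in a frame that is orthonormal up to a factor. -/
theorem kenmotsu_frame {c : SurfaceType} {A Φ : Plane →L[ℝ] R3} {n : R3} {G : PlaneForm}
    {s σ : ℝ} {u w : Plane} (hn : c.ip n n = c.normalSign) (hAn : ∀ v, c.ip (A v) n = 0)
    (hσ : σ * σ = 1) (hu : starAt G s A u = -(c.frameSign * σ) • A w)
    (hw : starAt G s A w = σ • A u)
    (hΦ : ∀ v, Φ v = A v + c.cross n (starAt G s A v)) :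
    Φ u = A u - (c.frameSign * σ) • c.cross n (A w) ∧ Φ w = σ • c.cross n (Φ u) := by
  have hε := c.frameSign_mul_self
  have h1 : Φ u = A u - (c.frameSign * σ) • c.cross n (A w) := by
    rw [hΦ, hu, map_smul, neg_smul, sub_eq_add_neg]
  refine ⟨h1, ?_⟩
  rw [h1, hΦ, hw, map_sub, map_smul, map_smul, c.cross_cross_normal hn (hAn w), smul_smul,
    smul_sub, smul_smul]
  rw [show σ * (c.frameSign * σ * -c.frameSign) = -1 by
    linear_combination -(c.frameSign * c.frameSign) * hσ - hε]
  module

theorem kenmotsu_normal {c : SurfaceType} {A Φ : Plane →L[ℝ] R3} {n : R3} {G : PlaneForm}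
    {s : ℝ} (hAn : ∀ v, c.ip (A v) n = 0)
    (hΦ : ∀ v, Φ v = A v + c.cross n (starAt G s A v)) (v : Plane) : c.ip (Φ v) n = 0 := by
  rw [hΦ, c.ip_add_left, hAn, c.ip_cross_self, add_zero]

/-- The form `dn + n × *dn` is conformal. -/
theorem exists_conformal_factor {c : SurfaceType} {A Φ : Plane →L[ℝ] R3} {n : R3}
    {G : PlaneForm} {s : ℝ} (hs : s * s = 1) (hG : ∀ v w, G v w = G w v)
    (hpos : ∃ v, 0 < G v v) (hdet : 0 < c.frameSign * gramDet G E₀ E₁)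
    (hn : c.ip n n = c.normalSign) (hAn : ∀ v, c.ip (A v) n = 0)
    (hΦ : ∀ v, Φ v = A v + c.cross n (starAt G s A v)) :
    ∃ l : ℝ, (∀ v w, c.ip (Φ v) (Φ w) = l * G v w) ∧ (c.frameSign = 1 → Φ ≠ 0 → 0 < l) ∧
      (Function.Injective Φ → l ≠ 0) := by
  have hε := c.frameSign_mul_self
  obtain ⟨u, w, huu, hww, huw, hor⟩ := exists_frame hG hs hε hpos hdet
  have hd : planeDet u w ≠ 0 := fun h => by simp [h] at hor
  obtain ⟨σ, -, hσ, hstar⟩ := exists_starAt_conformal hG hs hε one_ne_zero huu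
    (by rw [hww, mul_one]) huw
  obtain ⟨hst1, hst2⟩ := hstar A
  rw [mul_one] at hσ
  rw [hσ hor] at hst1 hst2
  obtain ⟨-, h2⟩ := kenmotsu_frame hn hAn (one_mul 1) hst1 hst2 hΦ
  rw [one_smul] at h2
  have hΦn := kenmotsu_normal hAn hΦ
  -- As G u u = 1, the factor l can only be the square of Φ u. The other two frame conditions follow
  -- from Φ w = n × Φ u.
  refine ⟨c.ip (Φ u) (Φ u), ip_eq_of_frame hG hd (by rw [huu, mul_one]) ?_ ?_, ?_, ?_⟩
  · rw [h2, c.ip_cross_normal hn (hΦn u), hww]; ring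
  · rw [h2, huw, mul_zero]
    have h3 := c.ip_cross_left n (Φ u) (Φ u)
    rw [c.ip_comm (c.cross n (Φ u))] at h3
    linarith
  · intro hc h0
    -- Φ u lies in the positive definite plane orthogonal to n, and Φ u = 0 would force Φ w = n × Φ
    -- u = 0, hence Φ = 0.
    refine SurfaceType.ip_self_pos hc hn (hΦn u) fun hu => h0 ?_
    refine ext_of_planeDet hd (by simpa using hu) ?_
    rw [h2, hu, map_zero]; rfl
  · intro hinj hl
    -- If l = 0 then Φ u is null, and the triple product rule makes Φ u × (n × Φ u) vanish. So Φ u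
    -- and Φ w are dependent, against injectivity.
    have hcr : c.cross (Φ u) (Φ w) = 0 := by
      rw [h2, c.cross_cross, hl, hΦn u]; simp
    have hu0 : Φ u = 0 := by
      ext i
      have h3 := c.smul_eq_smul_of_cross_eq_zero hcr i
      rw [← map_smul, ← map_smul] at h3
      have h4 := congrArg (planeDet u) (hinj h3)
      have h5 : planeDet u (Φ u i • w) = Φ u i * planeDet u w := by simp [planeDet]; ring
      have h6 : planeDet u (Φ w i • u) = 0 := by simp [planeDet]; ring
      rw [h5, h6, mul_eq_zero, or_iff_left hd] at h4
      simpa using h4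
    have : u = 0 := hinj (by rw [hu0, map_zero])
    rw [this] at huu
    simp at huu

/-- Orthonormal frames for the metric induced by `T = r (dn + n × *dn)`. -/
theorem exists_sign_of_frame {c : SurfaceType} {A Φ T : Plane →L[ℝ] R3} {n : R3}
    {G : PlaneForm} {s l r : ℝ} (hs : s * s = 1) (hG : ∀ v w, G v w = G w v)
    (hn : c.ip n n = c.normalSign) (hAn : ∀ v, c.ip (A v) n = 0)
    (hΦ : ∀ v, Φ v = A v + c.cross n (starAt G s A v))
    (hl : ∀ v w, c.ip (Φ v) (Φ w) = l * G v w) (hT : T = r • Φ) {e₁ e₂ : Plane}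
    (h11 : c.ip (T e₁) (T e₁) = 1) (h22 : c.ip (T e₂) (T e₂) = c.frameSign)
    (h12 : c.ip (T e₁) (T e₂) = 0) :
    ∃ σ : ℝ, σ * σ = 1 ∧ (0 < s * planeDet e₁ e₂ * l → σ = 1) ∧
      T e₂ = σ • c.cross n (T e₁) ∧
      r * (c.ip (T e₁) (A e₁) + c.frameSign * c.ip (T e₂) (A e₂)) = 1 := by
  have hε := c.frameSign_mul_self
  have hTG : ∀ v w, c.ip (T v) (T w) = r ^ 2 * l * G v w := fun v w => by
    rw [hT, smul_apply, smul_apply, c.ip_smul_left,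
      c.ip_smul_right, hl]
    ring
  rw [hTG] at h11 h22 h12
  have hm : r ^ 2 * l ≠ 0 := fun h => by rw [h] at h11; simp at h11
  have hr : r ≠ 0 := fun h => by simp [h] at hm
  have hκ : G e₁ e₁ ≠ 0 := fun h => by rw [h] at h11; simp at h11
  have h22' : G e₂ e₂ = c.frameSign * G e₁ e₁ := by
    apply mul_left_cancel₀ hm
    linear_combination h22 - c.frameSign * h11
  have h12' : G e₁ e₂ = 0 := (mul_eq_zero.1 h12).resolve_left hm
  -- For G the frame is orthogonal with common scale κ = G e₁ e₁ = 1 / (r² l), which is negative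
  -- exactly when l is.
  obtain ⟨σ, hσσ, hσ, hstar⟩ := exists_starAt_conformal hG hs hε hκ rfl h22' h12'
  obtain ⟨hst1, hst2⟩ := hstar A
  obtain ⟨hΦ1, hΦ2⟩ := kenmotsu_frame hn hAn hσσ hst1 hst2 hΦ
  have hT2 : T e₂ = σ • c.cross n (T e₁) := by
    rw [hT, smul_apply, smul_apply, map_smul, hΦ2,
      smul_comm]
  refine ⟨σ, hσσ, fun h => hσ ?_, hT2, ?_⟩
  · have hlκ : 0 < l * G e₁ e₁ := by
      have h3 : r ^ 2 * (l * G e₁ e₁) = 1 := by linear_combination h11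
      exact pos_of_mul_pos_right (h3 ▸ one_pos) (sq_nonneg r)
    have h4 : 0 < (s * planeDet e₁ e₂ * G e₁ e₁) * (l * l) := by
      have := mul_pos h hlκ; nlinarith
    exact pos_of_mul_pos_left h4 (mul_self_nonneg l)
  -- With T e₂ = σ (n × T e₁), skewness moves n × · onto A e₂, and the two terms of the trace
  -- assemble into Φ e₁.
  · have h3 : c.ip (T e₁) (A e₁) + c.frameSign * c.ip (T e₂) (A e₂) = c.ip (T e₁) (Φ e₁) := by
      rw [hΦ1, hT2, c.ip_smul_left, c.ip_cross_left, sub_eq_add_neg, ← neg_smul, c.ip_add_right,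
        c.ip_smul_right]
      ring
    rw [h3, ← c.ip_smul_right, ← smul_apply, ← hT, hTG, h11]

/-- The Hodge star on a surface is the model Hodge star on each tangent plane. -/
theorem hodgeStar_apply {M : Type*} [TopologicalSpace M] [ChartedSpace Plane M]
    [IsManifold (𝓡 2) ∞ M] (g : BilinField M) (o : SurfaceOrientation M) (α : OneForm M) (p : M)
    (hg : ∀ v w : TangentSpace (𝓡 2) p, g p v w = g p w v) (v : Plane) :
    (hodgeStar g o α p : Plane →L[ℝ] R3) v =
      starAt (g p : PlaneForm) ((o.sign p : ℤ) : ℝ) (α p : Plane →L[ℝ] R3) v := by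
  set G : PlaneForm := g p with hG
  set β : Plane →L[ℝ] R3 := α p with hβ
  have hM : gram g p = !![G E₀ E₀, G E₀ E₁; G E₀ E₁, G E₁ E₁] := by
    ext i j
    fin_cases i <;> fin_cases j <;> first | rfl | exact hg _ _
  have hdet : (gram g p).det = gramDet G E₀ E₁ := by
    rw [hM, Matrix.det_fin_two_of]; rfl
  have hinv : (gram g p)⁻¹ = (gramDet G E₀ E₁)⁻¹ • !![G E₁ E₁, -G E₀ E₁; -G E₀ E₁, G E₀ E₀] := by
    rw [Matrix.inv_def, hdet, Ring.inverse_eq_inv', hM, Matrix.adjugate_fin_two_of]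
  have hr : ∀ i, raise g α p i = (gram g p)⁻¹ i 0 • β E₀ + (gram g p)⁻¹ i 1 • β E₁ := fun i =>
    Fin.sum_univ_two _
  have hv0 : G v E₀ = v 0 * G E₀ E₀ + v 1 * G E₀ E₁ := by
    conv_lhs => rw [plane_eq v]
    simp only [map_add, map_smul, LinearMap.add_apply, LinearMap.smul_apply, smul_eq_mul]
    congr 2
    exact hg _ _
  have hv1 : G v E₁ = v 0 * G E₀ E₁ + v 1 * G E₁ E₁ := by
    conv_lhs => rw [plane_eq v]
    simp only [map_add, map_smul, LinearMap.add_apply, LinearMap.smul_apply, smul_eq_mul]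
  have h0 : (hodgeStar g o α p : Plane →L[ℝ] R3) v =
      volCoeff g o p • (v 1 • raise g α p 0 - v 0 • raise g α p 1) := rfl
  rw [h0, volCoeff, hr, hr, hdet, hinv, starAt, hv0, hv1]
  simp only [Matrix.smul_apply, Matrix.of_apply, Matrix.cons_val_zero, Matrix.cons_val_one,
    Matrix.cons_val', Matrix.cons_val_fin_one, smul_eq_mul, div_eq_mul_inv]
  module

/-! ### Passage between the surface and its charts. -/

section Charts

variable {M : Type*} [TopologicalSpace M] [ChartedSpace Plane M]

/-- The expression of a 1-form in the preferred chart at `p₀`. -/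
def localForm (η : OneForm M) (p₀ : M) (y : Plane) : Plane →L[ℝ] R3 :=
  (η ((extChartAt (𝓡 2) p₀).symm y)).comp (chartFrame p₀ y)

/-- The chart frame at `y`, as a linear endomorphism of the model plane. -/
def frameMap (p₀ : M) (y : Plane) : Plane →L[ℝ] Plane := chartFrame p₀ y

theorem hasMFDerivAt_diff {f : M → R3} (hf : ContMDiff (𝓡 2) 𝓘(ℝ, R3) ∞ f) (p : M) :
    HasMFDerivAt (𝓡 2) 𝓘(ℝ, R3) f p (diff f p) :=
  (hf.mdifferentiableAt (by simp)).hasMFDerivAt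

/-- Smoothness of a map at a point can be checked in the preferred chart. -/
theorem contMDiffAt_of_contDiffAt {f : M → R3} {p : M} (hc : ContinuousAt f p)
    (h : ContDiffAt ℝ ∞ (f ∘ (extChartAt (𝓡 2) p).symm) (extChartAt (𝓡 2) p p)) :
    ContMDiffAt (𝓡 2) 𝓘(ℝ, R3) ∞ f p := by
  rw [contMDiffAt_iff]
  exact ⟨hc, h.contDiffWithinAt⟩

/-- The fundamental theorem of calculus along curves. -/
theorem isIntegralOf_of_contMDiff {x : M → R3} {η : OneForm M}
    (hx : ContMDiff (𝓡 2) 𝓘(ℝ, R3) ∞ x) (h : ∀ p, HasMFDerivAt (𝓡 2) 𝓘(ℝ, R3) x p (η p)) :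
    IsIntegralOf x η := by
  refine ⟨h, fun γ hγ a b => ?_⟩
  have hd : ∀ t, HasDerivAt (x ∘ γ) (η (γ t) (mfderiv 𝓘(ℝ, ℝ) (𝓡 2) γ t (1 : ℝ))) t := fun t => by
    have h1 : HasFDerivAt (x ∘ γ) ((η (γ t) : Plane →L[ℝ] R3).comp
        (mfderiv 𝓘(ℝ, ℝ) (𝓡 2) γ t : ℝ →L[ℝ] Plane)) t :=
      ((h (γ t)).comp t (hγ.mdifferentiableAt (by simp)).hasMFDerivAt).hasFDerivAt
    exact h1.hasDerivAt
  have hc : ContDiff ℝ 1 (x ∘ γ) :=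
    contMDiff_iff_contDiff.1 ((hx.of_le (by simp)).comp hγ)
  have hd' : (fun t => η (γ t) (mfderiv 𝓘(ℝ, ℝ) (𝓡 2) γ t (1 : ℝ))) = deriv (x ∘ γ) :=
    funext fun t => (hd t).deriv.symm
  have hcont : Continuous fun t => η (γ t) (mfderiv 𝓘(ℝ, ℝ) (𝓡 2) γ t (1 : ℝ)) := by
    rw [hd']; exact hc.continuous_deriv le_rfl
  refine ⟨hcont.intervalIntegrable a b, ?_⟩
  exact (intervalIntegral.integral_eq_sub_of_hasDerivAt (fun t _ => hd t)
    (hcont.intervalIntegrable a b)).symm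

variable [IsManifold (𝓡 2) ∞ M]

theorem hasMFDerivAt_chart_symm {p₀ : M} {y : Plane} (hy : y ∈ (extChartAt (𝓡 2) p₀).target) :
    HasMFDerivAt 𝓘(ℝ, Plane) (𝓡 2) (extChartAt (𝓡 2) p₀).symm y (chartFrame p₀ y) :=
  (((contMDiffOn_extChartAt_symm (n := ∞) p₀).contMDiffAt
    ((isOpen_extChartAt_target p₀).mem_nhds hy)).mdifferentiableAt (by simp)).hasMFDerivAt

theorem hasFDerivAt_comp_chart_symm {f : M → R3} {η : OneForm M} {p₀ : M} {y : Plane}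
    (hy : y ∈ (extChartAt (𝓡 2) p₀).target)
    (hf : HasMFDerivAt (𝓡 2) 𝓘(ℝ, R3) f ((extChartAt (𝓡 2) p₀).symm y)
      (η ((extChartAt (𝓡 2) p₀).symm y))) :
    HasFDerivAt (f ∘ (extChartAt (𝓡 2) p₀).symm) (localForm η p₀ y) y :=
  (hf.comp y (hasMFDerivAt_chart_symm hy)).hasFDerivAt

theorem contDiffOn_comp_chart_symm {E : Type*} [NormedAddCommGroup E] [NormedSpace ℝ E]
    {f : M → E} (hf : ContMDiff (𝓡 2) 𝓘(ℝ, E) ∞ f) (p₀ : M) :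
    ContDiffOn ℝ ∞ (f ∘ (extChartAt (𝓡 2) p₀).symm) (extChartAt (𝓡 2) p₀).target :=
  contMDiffOn_iff_contDiffOn.1 (hf.comp_contMDiffOn (contMDiffOn_extChartAt_symm p₀))

theorem localForm_diff {f : M → R3} (hf : ContMDiff (𝓡 2) 𝓘(ℝ, R3) ∞ f) {p₀ : M} {y : Plane}
    (hy : y ∈ (extChartAt (𝓡 2) p₀).target) :
    localForm (diff f) p₀ y = fderiv ℝ (f ∘ (extChartAt (𝓡 2) p₀).symm) y :=
  (hasFDerivAt_comp_chart_symm hy (hasMFDerivAt_diff hf _)).fderiv.symm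

/-- Each tangent space is the model plane seen through the preferred chart of its own point. The
coordinate frame of the chart at p₀ is therefore inverse to the coordinate change that occurs in
`SurfaceOrientation`. -/
theorem chart_comp_frameMap {p₀ : M} {y : Plane} (hy : y ∈ (extChartAt (𝓡 2) p₀).target) :
    (tangentCoordChange (𝓡 2) ((extChartAt (𝓡 2) p₀).symm y) p₀ ((extChartAt (𝓡 2) p₀).symm y) :
      Plane →L[ℝ] Plane).comp (frameMap p₀ y) =
        ContinuousLinearMap.id ℝ Plane := by
  have h := mfderiv_extChartAt_comp_mfderivWithin_extChartAt_symm (I := 𝓡 2) hy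
  have hs : (extChartAt (𝓡 2) p₀).symm y ∈ (chartAt Plane p₀).source := by
    simpa using (extChartAt (𝓡 2) p₀).map_target hy
  rw [(hasMFDerivAt_extChartAt hs).mfderiv, mfderiv_chartAt_eq_tangentCoordChange hs,
    ModelWithCorners.range_eq_univ, mfderivWithin_univ] at h
  exact h

theorem frameMap_comp_chart {p₀ q : M} (hq : q ∈ (extChartAt (𝓡 2) p₀).source) :
    (frameMap p₀ (extChartAt (𝓡 2) p₀ q)).comp
      (mfderiv (𝓡 2) 𝓘(ℝ, Plane) (extChartAt (𝓡 2) p₀) q : Plane →L[ℝ] Plane) =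
        ContinuousLinearMap.id ℝ Plane := by
  have h := mfderivWithin_extChartAt_symm_comp_mfderiv_extChartAt' (I := 𝓡 2) hq
  rw [ModelWithCorners.range_eq_univ, mfderivWithin_univ] at h
  exact h

theorem frameMap_self (p : M) :
    frameMap p (extChartAt (𝓡 2) p p) = ContinuousLinearMap.id ℝ Plane := by
  have h := mfderivWithin_range_extChartAt_symm (I := 𝓡 2) (x := p)
  rw [ModelWithCorners.range_eq_univ, mfderivWithin_univ] at h
  exact h

theorem planeDet_eq_det (L : Plane →L[ℝ] Plane) :
    planeDet (L E₀) (L E₁) = LinearMap.det (L : Plane →ₗ[ℝ] Plane) := by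
  rw [← LinearMap.det_toMatrix (EuclideanSpace.basisFun (Fin 2) ℝ).toBasis, Matrix.det_fin_two]
  simp [LinearMap.toMatrix_apply, planeDet, E₀, E₁]
  ring

theorem planeDet_map (L : Plane →L[ℝ] Plane) (v w : Plane) :
    planeDet (L v) (L w) = planeDet (L E₀) (L E₁) * planeDet v w := by
  conv_lhs => rw [plane_eq v, plane_eq w]
  simp [planeDet]
  ring

theorem planeDet_frameMap_ne_zero {p₀ : M} {y : Plane}
    (hy : y ∈ (extChartAt (𝓡 2) p₀).target) :
    planeDet (frameMap p₀ y E₀) (frameMap p₀ y E₁) ≠ 0 := by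
  intro h
  have h1 := planeDet_eq_det (ContinuousLinearMap.id ℝ Plane)
  rw [← chart_comp_frameMap hy, ContinuousLinearMap.comp_apply,
    ContinuousLinearMap.comp_apply, planeDet_map, h, mul_zero] at h1
  rw [chart_comp_frameMap hy] at h1
  simp at h1

/-- Near the centre of a chart the coordinate frame keeps its orientation. -/
theorem eventually_orientation (o : SurfaceOrientation M) (p : M) :
    ∀ᶠ y in 𝓝 (extChartAt (𝓡 2) p p),
      0 < ((o.sign p : ℤ) : ℝ) * (((o.sign ((extChartAt (𝓡 2) p).symm y) : ℤ) : ℝ) *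
        planeDet (frameMap p y E₀) (frameMap p y E₁)) := by
  have h1 := (continuousAt_extChartAt_symm (I := 𝓡 2) p).eventually
    (p := fun q => 0 < ((o.sign p : ℤ) : ℝ) * ((o.sign q : ℤ) : ℝ) *
      LinearMap.det (tangentCoordChange (𝓡 2) q p q : Plane →ₗ[ℝ] Plane))
    (by rw [extChartAt_to_inv]; exact o.continuous' p)
  filter_upwards [h1, extChartAt_target_mem_nhds (I := 𝓡 2) p] with y hy hyt
  set q := (extChartAt (𝓡 2) p).symm y with hq
  set L : Plane →L[ℝ] Plane := tangentCoordChange (𝓡 2) q p q with hL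
  have h2 : LinearMap.det (L : Plane →ₗ[ℝ] Plane) *
      planeDet (frameMap p y E₀) (frameMap p y E₁) = 1 := by
    rw [planeDet_eq_det, ← LinearMap.det_comp]
    have := congrArg (fun T : Plane →L[ℝ] Plane => LinearMap.det (T : Plane →ₗ[ℝ] Plane))
      (chart_comp_frameMap hyt)
    exact this.trans LinearMap.det_id
  set D := LinearMap.det (L : Plane →ₗ[ℝ] Plane) with hD
  set d := planeDet (frameMap p y E₀) (frameMap p y E₁) with hd
  have hd0 : 0 < d * d := by
    have : d ≠ 0 := by rintro h; rw [h] at h2; simp at h2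
    exact mul_self_pos.2 this
  -- Since D d = 1, multiplying by d² > 0 replaces D by d.
  have h3 := mul_pos hy hd0
  have h4 : ((o.sign p : ℤ) : ℝ) * ((o.sign q : ℤ) : ℝ) * D * (d * d) =
    ((o.sign p : ℤ) : ℝ) * (((o.sign q : ℤ) : ℝ) * d) := by
    linear_combination ((o.sign p : ℤ) : ℝ) * ((o.sign q : ℤ) : ℝ) * d * h2
  exact h4 ▸ h3

theorem sign_mul_self (o : SurfaceOrientation M) (p : M) :
    ((o.sign p : ℤ) : ℝ) * ((o.sign p : ℤ) : ℝ) = 1 := by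
  rcases Int.units_eq_one_or (o.sign p) with h | h <;> simp [h]

/-- A primitive in a chart gives a local primitive on the surface. -/
theorem hasMFDerivAt_comp_chart {F : Plane → R3} {η : OneForm M} {p₀ q : M}
    (hq : q ∈ (extChartAt (𝓡 2) p₀).source)
    (hF : HasFDerivAt F (localForm η p₀ (extChartAt (𝓡 2) p₀ q)) (extChartAt (𝓡 2) p₀ q)) :
    HasMFDerivAt (𝓡 2) 𝓘(ℝ, R3) (F ∘ extChartAt (𝓡 2) p₀) q (η q) := by
  have hs : q ∈ (chartAt Plane p₀).source := by simpa using hq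
  have h1 := hF.hasMFDerivAt.comp q (mdifferentiableAt_extChartAt (I := 𝓡 2) hs).hasMFDerivAt
  have h2 : (localForm η p₀ (extChartAt (𝓡 2) p₀ q)).comp
      (mfderiv (𝓡 2) 𝓘(ℝ, Plane) (extChartAt (𝓡 2) p₀) q : Plane →L[ℝ] Plane) =
        (η q : Plane →L[ℝ] R3) := by
    have h3 := frameMap_comp_chart hq
    have h4 : (η ((extChartAt (𝓡 2) p₀).symm (extChartAt (𝓡 2) p₀ q)) : Plane →L[ℝ] R3) =
        (η q : Plane →L[ℝ] R3) := by rw [(extChartAt (𝓡 2) p₀).left_inv hq]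
    calc _ = (η ((extChartAt (𝓡 2) p₀).symm (extChartAt (𝓡 2) p₀ q)) : Plane →L[ℝ] R3).comp
          ((frameMap p₀ (extChartAt (𝓡 2) p₀ q)).comp
          (mfderiv (𝓡 2) 𝓘(ℝ, Plane) (extChartAt (𝓡 2) p₀) q : Plane →L[ℝ] Plane)) := rfl
      _ = _ := by rw [h3, h4]; rfl
  rw [← h2]
  exact h1

end Charts

/-! ### Gluing local primitives by a covering space. -/

/-- Local functions with locally constant differences on a simply connected space are, up to
locally constant functions, the restrictions of a global function. -/
theorem exists_global_of_local {X V : Type*} [TopologicalSpace X] [SimplyConnectedSpace X]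
    [LocallyPathConnectedSpace X] [AddCommGroup V] (U : X → Set X) (hU : ∀ p, IsOpen (U p))
    (hmem : ∀ p, p ∈ U p) (f : X → X → V)
    (hf : ∀ p p', ∀ q ∈ U p ∩ U p', ∀ᶠ z in 𝓝 q, f p z - f p' z = f p q - f p' q) :
    ∃ x : X → V, ∀ p, ∀ q ∈ U p, ∀ᶠ z in 𝓝 q, x z - f p z = x q - f p q := by
  -- With discrete fibres the bundle below is a covering. Its transition maps are the translations
  -- by f i - f j, continuous because these differences are locally constant.
  let _ : TopologicalSpace V := ⊥
  have : DiscreteTopology V := ⟨rfl⟩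
  let Z : FiberBundleCore X X V :=
    { baseSet := U
      isOpen_baseSet := hU
      indexAt := id
      mem_baseSet_at := hmem
      coordChange := fun i j q v => v + (f i q - f j q)
      coordChange_self := fun i q _ v => by simp
      continuousOn_coordChange := by
        rintro i j ⟨q, v⟩ ⟨hq, -⟩
        refine ContinuousAt.continuousWithinAt ?_
        have h1 : (fun z : X × V => z.2 + (f i z.1 - f j z.1)) =ᶠ[𝓝 (q, v)]
            fun _ => v + (f i q - f j q) := by
          have h2 : ∀ᶠ z : X × V in 𝓝 (q, v), z.2 = v := by
            have : ∀ᶠ w in 𝓝 v, w = v := by simp [nhds_discrete]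
            exact (continuous_snd.tendsto (q, v)).eventually this
          have h3 := ((continuous_fst (X := X) (Y := V)).tendsto (q, v)).eventually
            (hf i j q hq)
          filter_upwards [h2, h3] with z hz hz'
          rw [hz, hz']
        exact continuousAt_const.congr h1.symm
      coordChange_comp := fun i j k q _ v => by abel }
  obtain ⟨p₀⟩ : Nonempty X := inferInstance
  have hcov : IsCoveringMap (Z.proj) := FiberBundle.isCoveringMap (F := V) (E := Z.Fiber)
  obtain ⟨F, ⟨-, hF⟩, -⟩ := hcov.existsUnique_continuousMap_lifts (ContinuousMap.id X) p₀
    (⟨p₀, (0 : V)⟩ : Z.TotalSpace) rfl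
  have hproj : ∀ q, (F q).1 = q := fun q => congrFun hF q
  let val : Z.TotalSpace → V := fun e => e.2
  -- The lift F of the identity is a global section. Its value at q is recorded in the
  -- trivialisation of index q, hence the term f q q; in the trivialisation p it reads x - f p,
  -- which is continuous into a discrete space.
  refine ⟨fun q => f q q + val (F q), fun p q hq => ?_⟩
  have hc : ContinuousAt (fun z => (Z.localTriv p (F z)).2) q := by
    refine continuous_snd.continuousAt.comp ?_
    refine ContinuousAt.comp (f := F) ?_ F.continuous.continuousAt
    refine (Z.localTriv p).continuousOn.continuousAt ?_
    refine (Z.localTriv p).open_source.mem_nhds ?_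
    rw [Z.mem_localTriv_source, hproj]
    exact hq
  have hval : ∀ z, (Z.localTriv p (F z)).2 = f z z + val (F z) - f p z := fun z => by
    have : (Z.localTriv p (F z)).2 = val (F z) + (f (F z).1 (F z).1 - f p (F z).1) := rfl
    rw [this, hproj]; abel
  have hev : ∀ᶠ z in 𝓝 q, (Z.localTriv p (F z)).2 = (Z.localTriv p (F q)).2 :=
    hc.eventually (p := fun w => w = (Z.localTriv p (F q)).2) (by simp [nhds_discrete])
  filter_upwards [hev] with z hz
  rwa [hval, hval] at hz

/-! ### Primitives of closed 1-forms. -/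

section Primitive

variable {M : Type*} [TopologicalSpace M] [ChartedSpace Plane M]

/-- On a pair (v, w) the exterior derivative is the antisymmetrised derivative; its vanishing is the
hypothesis of the Poincaré lemma on a convex set. -/
theorem fderiv_localForm_symm {η : OneForm M} (hcl : IsClosedForm η) {p : M} {y : Plane}
    (hy : y ∈ (extChartAt (𝓡 2) p).target) (hd : DifferentiableAt ℝ (localForm η p) y)
    (v w : Plane) : fderiv ℝ (localForm η p) y v w = fderiv ℝ (localForm η p) y w v := by
  have h0 := hcl p y hy
  have hform : formInChart η p = fun y =>
      ContinuousAlternatingMap.ofSubsingletonLIE (𝕜 := ℝ) (E := Plane) (F := R3) (0 : Fin 1)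
        (localForm η p y) := rfl
  have hdf : DifferentiableAt ℝ (formInChart η p) y := by
    rw [hform]
    exact (ContinuousAlternatingMap.ofSubsingletonLIE (𝕜 := ℝ) (E := Plane) (F := R3)
      (0 : Fin 1)).differentiable.differentiableAt.comp y hd
  have h1 := extDeriv_apply hdf ![v, w]
  rw [h0] at h1
  have hw : (fun z => formInChart η p z ((0 : Fin 2).removeNth ![v, w])) =
      fun z => localForm η p z w := rfl
  have hv : (fun z => formInChart η p z ((1 : Fin 2).removeNth ![v, w])) =
      fun z => localForm η p z v := rfl
  rw [Fin.sum_univ_two, hw, hv] at h1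
  have hcl : ∀ u : Plane, fderiv ℝ (fun z => localForm η p z u) y =
      (fderiv ℝ (localForm η p) y).flip u := fun u => by
    have := (hd.hasFDerivAt.clm_apply (hasFDerivAt_const u y)).fderiv
    simpa using this
  rw [hcl, hcl] at h1
  simp at h1
  rw [← sub_eq_add_neg] at h1
  exact sub_eq_zero.1 h1.symm

variable [IsManifold (𝓡 2) ∞ M]

/-- Two maps with the same differential near `q` differ by a constant near `q`. -/
theorem eventually_sub_eq {f f' : M → R3} {η : OneForm M} {q : M}
    (hf : ∀ᶠ z in 𝓝 q, HasMFDerivAt (𝓡 2) 𝓘(ℝ, R3) f z (η z))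
    (hf' : ∀ᶠ z in 𝓝 q, HasMFDerivAt (𝓡 2) 𝓘(ℝ, R3) f' z (η z)) :
    ∀ᶠ z in 𝓝 q, f z - f' z = f q - f' q := by
  have h1 := (continuousAt_extChartAt_symm (I := 𝓡 2) q).eventually
    (by rw [extChartAt_to_inv]; exact hf.and hf')
  obtain ⟨r, hr, hball⟩ := Metric.eventually_nhds_iff_ball.1
    (h1.and (extChartAt_target_mem_nhds (I := 𝓡 2) q))
  have hd : ∀ y ∈ Metric.ball (extChartAt (𝓡 2) q q) r, HasFDerivAt
      (fun y => (f ∘ (extChartAt (𝓡 2) q).symm) y - (f' ∘ (extChartAt (𝓡 2) q).symm) y)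
      (0 : Plane →L[ℝ] R3) y := fun y hy => by
    obtain ⟨⟨ha, hb⟩, ht⟩ := hball y hy
    simpa using (hasFDerivAt_comp_chart_symm ht ha).sub (hasFDerivAt_comp_chart_symm ht hb)
  have hconst : ∀ y ∈ Metric.ball (extChartAt (𝓡 2) q q) r,
      (f ∘ (extChartAt (𝓡 2) q).symm) y - (f' ∘ (extChartAt (𝓡 2) q).symm) y = f q - f' q := by
    intro y hy
    have := Metric.isOpen_ball.is_const_of_fderiv_eq_zero (𝕜 := ℝ)
      (convex_ball _ _).isPreconnected
      (fun y hy => (hd y hy).differentiableAt.differentiableWithinAt)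
      (fun y hy => (hd y hy).fderiv) hy (Metric.mem_ball_self hr)
    simpa using this
  filter_upwards [(continuousAt_extChartAt (I := 𝓡 2) q).eventually (Metric.ball_mem_nhds _ hr),
    extChartAt_source_mem_nhds (I := 𝓡 2) q] with z hz hzs
  have := hconst _ hz
  simpa only [Function.comp_apply, (extChartAt (𝓡 2) q).left_inv hzs] using this

/-- A 1-form is smooth near the centres of the preferred charts. -/
def IsSmoothNearCentres (η : OneForm M) : Prop :=
  ∀ p : M, ∃ r > 0, Metric.ball (extChartAt (𝓡 2) p p) r ⊆ (extChartAt (𝓡 2) p).target ∧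
    ContDiffOn ℝ ∞ (localForm η p) (Metric.ball (extChartAt (𝓡 2) p p) r)

/-- In the chart centred at p the derivative of x is the local expression of η, which is smooth near
the centre. -/
theorem contMDiff_of_hasMFDerivAt {x : M → R3} {η : OneForm M} (hη : IsSmoothNearCentres η)
    (h : ∀ p, HasMFDerivAt (𝓡 2) 𝓘(ℝ, R3) x p (η p)) : ContMDiff (𝓡 2) 𝓘(ℝ, R3) ∞ x := by
  intro p
  obtain ⟨r, hr, hsub, hs⟩ := hη p
  refine contMDiffAt_of_contDiffAt (h p).continuousAt ?_
  have hd : ∀ y ∈ Metric.ball (extChartAt (𝓡 2) p p) r,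
      HasFDerivAt (x ∘ (extChartAt (𝓡 2) p).symm) (localForm η p y) y := fun y hy =>
    hasFDerivAt_comp_chart_symm (hsub hy) (h _)
  refine ContDiffOn.contDiffAt ?_ (Metric.ball_mem_nhds _ hr)
  rw [contDiffOn_infty_iff_fderiv_of_isOpen Metric.isOpen_ball]
  exact ⟨fun y hy => (hd y hy).differentiableAt.differentiableWithinAt,
    hs.congr fun y hy => (hd y hy).fderiv⟩

/-- A closed 1-form on a simply connected surface has a primitive. -/
theorem exists_primitive [SimplyConnectedSpace M] {η : OneForm M} (hη : IsSmoothNearCentres η)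
    (hcl : IsClosedForm η) : ∃ x : M → R3, ∀ p, HasMFDerivAt (𝓡 2) 𝓘(ℝ, R3) x p (η p) := by
  have : LocallyPathConnectedSpace M := ChartedSpace.locallyPathConnectedSpace Plane M
  have hloc : ∀ p : M, ∃ (U : Set M) (f : M → R3), IsOpen U ∧ p ∈ U ∧
      ∀ q ∈ U, HasMFDerivAt (𝓡 2) 𝓘(ℝ, R3) f q (η q) := by
    intro p
    obtain ⟨r, hr, hsub, hs⟩ := hη p
    have hdiff := hs.differentiableOn (by simp)
    -- The Poincaré lemma on a ball around the centre of the chart.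
    obtain ⟨F, hF⟩ := Convex.exists_forall_hasFDerivAt_of_fderiv_symmetric
      (convex_ball (extChartAt (𝓡 2) p p) r) Metric.isOpen_ball hdiff fun y hy v w => fderiv_localForm_symm hcl (hsub hy)
        (hdiff.differentiableAt (Metric.isOpen_ball.mem_nhds hy)) v w
    refine ⟨(extChartAt (𝓡 2) p).source ∩ extChartAt (𝓡 2) p ⁻¹'
        Metric.ball (extChartAt (𝓡 2) p p) r,
      F ∘ extChartAt (𝓡 2) p, isOpen_extChartAt_preimage' p Metric.isOpen_ball,
      ⟨mem_extChartAt_source p, Metric.mem_ball_self hr⟩, fun q hq => ?_⟩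
    exact hasMFDerivAt_comp_chart hq.1 (hF _ hq.2)
  choose U f hU hmem hf using hloc
  have hev : ∀ p, ∀ q ∈ U p, ∀ᶠ z in 𝓝 q, HasMFDerivAt (𝓡 2) 𝓘(ℝ, R3) (f p) z (η z) :=
    fun p q hq => Filter.mem_of_superset ((hU p).mem_nhds hq) fun z hz => hf p z hz
  obtain ⟨x, hx⟩ := exists_global_of_local U hU hmem f fun p p' q hq =>
    eventually_sub_eq (hev p q hq.1) (hev p' q hq.2)
  refine ⟨x, fun p => ?_⟩
  have h1 : x =ᶠ[𝓝 p] fun z => f p z + (x p - f p p) := by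
    filter_upwards [hx p p (hmem p)] with z hz
    rw [← hz]; abel
  have h2 : HasMFDerivAt (𝓡 2) 𝓘(ℝ, R3) (fun z => f p z + (x p - f p p)) p (η p) := by
    have := (hf p p (hmem p)).add (hasMFDerivAt_const (I := 𝓡 2) (I' := 𝓘(ℝ, R3)) (x p - f p p) p)
    have e : (η p : Plane →L[ℝ] R3) + 0 = η p := add_zero _
    exact e ▸ this
  exact h2.congr_of_eventuallyEq h1

end Primitive

/-! ### Calculus of the ambient products and of the volume factor. -/

theorem hasFDerivAt_ip (c : SurfaceType) {X Y : Plane → R3} {X' Y' : Plane →L[ℝ] R3} {y : Plane}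
    (hX : HasFDerivAt X X' y) (hY : HasFDerivAt Y Y' y) :
    ∃ L : Plane →L[ℝ] ℝ, HasFDerivAt (fun z => c.ip (X z) (Y z)) L y ∧
      ∀ v, L v = c.ip (X' v) (Y y) + c.ip (X y) (Y' v) := by
  have hx := hasFDerivAt_pi'.1 hX
  have hy := hasFDerivAt_pi'.1 hY
  refine ⟨_, (((hx 0).mul (hy 0)).add ((hx 1).mul (hy 1))).add
    (((hx 2).mul (hy 2)).const_mul c.ambientSign), fun v => ?_⟩
  simp [SurfaceType.ip]
  ring

theorem contDiffOn_ip (c : SurfaceType) {X Y : Plane → R3} {s : Set Plane}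
    (hX : ContDiffOn ℝ ∞ X s) (hY : ContDiffOn ℝ ∞ Y s) :
    ContDiffOn ℝ ∞ (fun z => c.ip (X z) (Y z)) s := by
  have hx := contDiffOn_pi.1 hX
  have hy := contDiffOn_pi.1 hY
  exact (((hx 0).mul (hy 0)).add ((hx 1).mul (hy 1))).add
    (contDiffOn_const.mul ((hx 2).mul (hy 2)))

theorem contDiffOn_cross (c : SurfaceType) {X Y : Plane → R3} {s : Set Plane}
    (hX : ContDiffOn ℝ ∞ X s) (hY : ContDiffOn ℝ ∞ Y s) :
    ContDiffOn ℝ ∞ (fun z => c.cross (X z) (Y z)) s := by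
  have hx := contDiffOn_pi.1 hX
  have hy := contDiffOn_pi.1 hY
  refine contDiffOn_pi.2 fun i => ?_
  fin_cases i
  · exact ((hx 1).mul (hy 2)).sub ((hy 1).mul (hx 2))
  · exact ((hx 2).mul (hy 0)).sub ((hy 2).mul (hx 0))
  · exact contDiffOn_const.mul (((hx 0).mul (hy 1)).sub ((hy 0).mul (hx 1)))

/-- `√|D|` is smooth where `D` is nonzero of constant sign. -/
theorem contDiffOn_sqrt_abs {D : Plane → ℝ} {s : Set Plane} {ε : ℝ} (hε : ε * ε = 1)
    (hD : ContDiffOn ℝ ∞ D s) (hpos : ∀ y ∈ s, 0 < ε * D y) :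
    ContDiffOn ℝ ∞ (fun y => Real.sqrt |D y|) s := by
  have h1 : ContDiffOn ℝ ∞ (fun y => Real.sqrt (ε * D y)) s :=
    (contDiffOn_const.mul hD).sqrt fun y hy => (hpos y hy).ne'
  refine h1.congr fun y hy => ?_
  have h2 : |ε| = 1 := by rcases mul_self_eq_one_iff.1 hε with h | h <;> simp [h]
  rw [← abs_of_pos (hpos y hy), abs_mul, h2, one_mul]

/-- Replaces the orientation sign t at a moving point, corrected by the sign of the coordinate
frame, by the constant sign s at the centre of the chart. This removes every discontinuous sign from
the Hodge star in coordinates. -/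
theorem orientation_factor {s t d : ℝ} (hs : s * s = 1) (ht : t * t = 1) (h : 0 < s * (t * d)) :
    t * (d / |d|) = s := by
  have hd : d ≠ 0 := by rintro rfl; simp at h
  have h1 := abs_of_pos h
  have hs1 : |s| = 1 := by rcases mul_self_eq_one_iff.1 hs with h | h <;> simp [h]
  have ht1 : |t| = 1 := by rcases mul_self_eq_one_iff.1 ht with h | h <;> simp [h]
  rw [abs_mul, abs_mul, hs1, ht1, one_mul, one_mul] at h1
  have : |d| ≠ 0 := abs_ne_zero.2 hd
  rw [← mul_div_assoc, div_eq_iff this, h1]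
  linear_combination -(t * d) * hs

/-! ### The form dn + n × *dn in coordinates. -/

section Surface

variable {M : Type*} [TopologicalSpace M] [ChartedSpace Plane M]

/-- The metric has the right signature at every point. -/
theorem IsMetric.signature {c : SurfaceType} {g : BilinField M} (hg : IsMetric c g) (p : M) :
    (∃ v : Plane, 0 < (g p : PlaneForm) v v) ∧
      0 < c.frameSign * gramDet (g p : PlaneForm) E₀ E₁ := by
  have hE : E₀ ≠ 0 := fun h => by simpa [E₀] using congrArg (fun v : Plane => v 0) h
  have hs : ∀ v w : Plane, (g p : PlaneForm) v w = (g p : PlaneForm) w v := hg.1 p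
  obtain ⟨-, -, h⟩ := hg
  cases c
  · refine ⟨⟨E₀, h p _ hE⟩, ?_⟩
    simpa only [SurfaceType.frameSign, one_mul] using gramDet_pos_of_posDef hs (h p)
  · refine ⟨⟨E₀, h p _ hE⟩, ?_⟩
    simpa only [SurfaceType.frameSign, one_mul] using gramDet_pos_of_posDef hs (h p)
  · obtain ⟨⟨v, hv⟩, ⟨w, hw⟩⟩ := h p
    refine ⟨⟨v, hv⟩, ?_⟩
    have := gramDet_neg_of_lorentz hs hv hw
    simp only [SurfaceType.frameSign]
    linarith

variable [IsManifold (𝓡 2) ∞ M]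

theorem kenmotsuForm_apply {c : SurfaceType} {g : BilinField M} (o : SurfaceOrientation M)
    (n : M → R3) (p : M) (hg : ∀ v w : TangentSpace (𝓡 2) p, g p v w = g p w v) (v : Plane) :
    (kenmotsuForm c g o n p : Plane →L[ℝ] R3) v = (diff n p : Plane →L[ℝ] R3) v +
      c.cross (n p) (starAt (g p : PlaneForm) ((o.sign p : ℤ) : ℝ)
        (diff n p : Plane →L[ℝ] R3) v) := by
  rw [← hodgeStar_apply g o (diff n) p hg v]
  rfl

theorem localForm_self (η : OneForm M) (p : M) :
    localForm η p (extChartAt (𝓡 2) p p) = (η p : Plane →L[ℝ] R3) := by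
  have h1 : localForm η p (extChartAt (𝓡 2) p p) =
    (η ((extChartAt (𝓡 2) p).symm (extChartAt (𝓡 2) p p)) : Plane →L[ℝ] R3).comp
      (frameMap p (extChartAt (𝓡 2) p p)) := rfl
  have h2 : (η ((extChartAt (𝓡 2) p).symm (extChartAt (𝓡 2) p p)) : Plane →L[ℝ] R3) =
      (η p : Plane →L[ℝ] R3) := by rw [extChartAt_to_inv]
  rw [h1, frameMap_self, h2]
  rfl

/-- The derivative of a unit normal field is tangent. -/
theorem ip_diff_self {c : SurfaceType} {n : M → R3} {p : M} {a : ℝ}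
    (hd : HasMFDerivAt (𝓡 2) 𝓘(ℝ, R3) n p (diff n p)) (hn : ∀ q, c.ip (n q) (n q) = a)
    (v : Plane) : c.ip ((diff n p : Plane →L[ℝ] R3) v) (n p) = 0 := by
  have h0 := hasFDerivAt_comp_chart_symm (η := diff n) (mem_extChartAt_target (I := 𝓡 2) p)
    (by rw [extChartAt_to_inv]; exact hd)
  rw [localForm_self] at h0
  set A : Plane →L[ℝ] R3 := diff n p with hA
  have h1 : HasFDerivAt (n ∘ (extChartAt (𝓡 2) p).symm) A (extChartAt (𝓡 2) p p) := h0
  obtain ⟨L, hL, hLv⟩ := hasFDerivAt_ip c h1 h1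
  have h2 : L = 0 := by
    refine hL.unique ?_
    have : (fun z => c.ip ((n ∘ (extChartAt (𝓡 2) p).symm) z)
      ((n ∘ (extChartAt (𝓡 2) p).symm) z)) = fun _ => a := funext fun z => hn _
    rw [this]
    exact hasFDerivAt_const _ _
  have h3 := hLv v
  rw [h2, Function.comp_apply, extChartAt_to_inv, c.ip_comm (n p)] at h3
  have h4 : (0 : ℝ) = c.ip (A v) (n p) + c.ip (A v) (n p) := h3
  have h5 : c.ip (A v) (n p) = 0 := by linarith
  exact h5

/-- The coefficients of `g` in the preferred chart at `p₀`. -/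
def chartCoeff (g : BilinField M) (p₀ : M) (u v y : Plane) : ℝ :=
  (g ((extChartAt (𝓡 2) p₀).symm y) : PlaneForm) (frameMap p₀ y u) (frameMap p₀ y v)

/-- The Gram determinant of `g` in the preferred chart at `p₀`. -/
def chartGram (g : BilinField M) (p₀ : M) (y : Plane) : ℝ :=
  gramDet (g ((extChartAt (𝓡 2) p₀).symm y) : PlaneForm) (frameMap p₀ y E₀) (frameMap p₀ y E₁)

/-- The form `dn + n × *dn` in the preferred chart, where the chart is positively oriented up to
the sign at its centre. -/
theorem localForm_kenmotsuForm {c : SurfaceType} {g : BilinField M} (o : SurfaceOrientation M)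
    (n : M → R3) (hg : ∀ (p : M) (v w : TangentSpace (𝓡 2) p), g p v w = g p w v) {p : M}
    {y : Plane} (hy : 0 < ((o.sign p : ℤ) : ℝ) *
      (((o.sign ((extChartAt (𝓡 2) p).symm y) : ℤ) : ℝ) *
        planeDet (frameMap p y E₀) (frameMap p y E₁))) (v : Plane) :
    localForm (kenmotsuForm c g o n) p y v = localForm (diff n) p y v +
      c.cross (n ((extChartAt (𝓡 2) p).symm y))
        ((((o.sign p : ℤ) : ℝ) * Real.sqrt |chartGram g p y| / chartGram g p y) •
          (chartCoeff g p v E₁ y • localForm (diff n) p y E₀ -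
            chartCoeff g p v E₀ y • localForm (diff n) p y E₁)) := by
  have hd : planeDet (frameMap p y E₀) (frameMap p y E₁) ≠ 0 := fun h => by simp [h] at hy
  have h1 := kenmotsuForm_apply (c := c) o n ((extChartAt (𝓡 2) p).symm y) (hg _)
    (frameMap p y v)
  have h2 := starAt_eq (G := (g ((extChartAt (𝓡 2) p).symm y) : PlaneForm)) (hg _)
    ((o.sign ((extChartAt (𝓡 2) p).symm y) : ℤ) : ℝ)
    (diff n ((extChartAt (𝓡 2) p).symm y) : Plane →L[ℝ] R3) hd (frameMap p y v)
  rw [orientation_factor (sign_mul_self o _) (sign_mul_self o _) hy] at h2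
  exact h1.trans (congrArg (fun z => localForm (diff n) p y v +
    c.cross (n ((extChartAt (𝓡 2) p).symm y)) z) h2)

/-- The formula of `localForm_kenmotsuForm` has smooth ingredients: the Gram determinant never
vanishes and keeps the sign ε, so √|D| / D is smooth. Working near centres is what makes the
orientation sign constant. -/
theorem isSmoothNearCentres_kenmotsuForm {c : SurfaceType} {g : BilinField M}
    (o : SurfaceOrientation M) {n : M → R3} {h : M → ℝ} (hg : IsMetric c g)
    (hn : ContMDiff (𝓡 2) 𝓘(ℝ, R3) ∞ n)
    (hh : ∀ p₀ : M, ContDiffOn ℝ ∞ (h ∘ (extChartAt (𝓡 2) p₀).symm)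
      (extChartAt (𝓡 2) p₀).target) :
    IsSmoothNearCentres fun p => h p • kenmotsuForm c g o n p := by
  intro p
  obtain ⟨r, hr, hball⟩ := Metric.eventually_nhds_iff_ball.1
    ((eventually_orientation o p).and (extChartAt_target_mem_nhds (I := 𝓡 2) p))
  set B := Metric.ball (extChartAt (𝓡 2) p p) r with hB
  have hsub : B ⊆ (extChartAt (𝓡 2) p).target := fun y hy => (hball y hy).2
  refine ⟨r, hr, hsub, contDiffOn_clm_apply.2 fun v => ?_⟩
  have hN := (contDiffOn_comp_chart_symm hn p).mono hsub
  have hdN : ContDiffOn ℝ ∞ (localForm (diff n) p) B :=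
    ((contDiffOn_infty_iff_fderiv_of_isOpen Metric.isOpen_ball).1 hN).2.congr fun y hy =>
      localForm_diff hn (hsub hy)
  have hdNv : ∀ u, ContDiffOn ℝ ∞ (fun y => localForm (diff n) p y u) B :=
    contDiffOn_clm_apply.1 hdN
  have hC : ∀ u w, ContDiffOn ℝ ∞ (chartCoeff g p u w) B := fun u w => (hg.2.1 p u w).mono hsub
  have hG : ContDiffOn ℝ ∞ (chartGram g p) B :=
    ((hC E₀ E₀).mul (hC E₁ E₁)).sub ((hC E₀ E₁).mul (hC E₀ E₁))
  have hGpos : ∀ y ∈ B, 0 < c.frameSign * chartGram g p y := fun y hy => by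
    have hd := planeDet_frameMap_ne_zero (hsub hy)
    rw [chartGram, gramDet_eq (hg.1 _), mul_left_comm]
    have := (hg.signature ((extChartAt (𝓡 2) p).symm y)).2
    exact mul_pos (sq_pos_of_ne_zero hd) this
  have hG0 : ∀ y ∈ B, chartGram g p y ≠ 0 := fun y hy h0 => by
    have := hGpos y hy
    rw [h0, mul_zero] at this
    exact this.false
  have hmain := ((hh p).mono hsub).smul ((hdNv v).add (contDiffOn_cross c hN
    (((contDiffOn_const (c := ((o.sign p : ℤ) : ℝ))).mul
      (contDiffOn_sqrt_abs c.frameSign_mul_self hG hGpos)).div hG hG0 |>.smul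
      (((hC v E₁).smul (hdNv E₀)).sub ((hC v E₀).smul (hdNv E₁))))))
  refine hmain.congr fun y hy => ?_
  have h1 := localForm_kenmotsuForm (c := c) o n hg.1 (hball y hy).1 v
  have h2 : localForm (fun p => h p • kenmotsuForm c g o n p) p y v =
    h ((extChartAt (𝓡 2) p).symm y) • localForm (kenmotsuForm c g o n) p y v := rfl
  rw [h2, h1]
  rfl

end Surface

theorem two_le_infty : (2 : ℕ∞ω) ≤ ∞ :=
  WithTop.coe_le_coe.2 le_top

/-! ### Part (a): from the surface to the formula. -/

section Direct

variable {M : Type*} [TopologicalSpace M] [ChartedSpace Plane M]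

theorem inducedMetric_symm (c : SurfaceType) (x : M → R3) (p : M) (v w : TangentSpace (𝓡 2) p) :
    inducedMetric c x p v w = inducedMetric c x p w v :=
  c.ip_comm _ _

/-- The metric induced on a surface has the right signature at every point. -/
theorem IsSurface.signature {c : SurfaceType} {x : M → R3} (hx : IsSurface c x) (p : M) :
    (∃ v : Plane, 0 < (inducedMetric c x p : PlaneForm) v v) ∧
      0 < c.frameSign * gramDet (inducedMetric c x p : PlaneForm) E₀ E₁ := by
  have hE : E₀ ≠ 0 := fun h => by simpa [E₀] using congrArg (fun v : Plane => v 0) h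
  have hs : ∀ v w : Plane, (inducedMetric c x p : PlaneForm) v w =
    (inducedMetric c x p : PlaneForm) w v := inducedMetric_symm c x p
  obtain ⟨-, hinj, h⟩ := hx
  cases c
  · have hpos : ∀ v : Plane, v ≠ 0 →
        0 < (inducedMetric .euclidean x p : PlaneForm) v v := fun v hv => by
      have h0 : (diff x p : Plane →L[ℝ] R3) v ≠ 0 := fun h0 => hv (hinj p
        (h0.trans (map_zero (diff x p : Plane →L[ℝ] R3)).symm))
      have h1 : 0 < SurfaceType.euclidean.ip ((diff x p : Plane →L[ℝ] R3) v)
          ((diff x p : Plane →L[ℝ] R3) v) := by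
        by_contra hneg
        simp only [SurfaceType.ip, SurfaceType.ambientSign, not_lt] at hneg
        set w := (diff x p : Plane →L[ℝ] R3) v
        apply h0
        ext i
        fin_cases i <;> simp <;>
          nlinarith [mul_self_nonneg (w 0), mul_self_nonneg (w 1), mul_self_nonneg (w 2)]
      exact h1
    refine ⟨⟨E₀, hpos _ hE⟩, ?_⟩
    simpa only [SurfaceType.frameSign, one_mul] using gramDet_pos_of_posDef hs hpos
  · refine ⟨⟨E₀, h p _ hE⟩, ?_⟩
    simpa only [SurfaceType.frameSign, one_mul] using gramDet_pos_of_posDef hs (h p)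
  · obtain ⟨⟨v, hv⟩, ⟨w, hw⟩⟩ := h p
    refine ⟨⟨v, hv⟩, ?_⟩
    have := gramDet_neg_of_lorentz hs hv hw
    simp only [SurfaceType.frameSign]
    linarith

variable [IsManifold (𝓡 2) ∞ M]

/-- Positively oriented orthonormal frames, with the relation to the Gauss map. -/
theorem IsSurface.exists_frame {c : SurfaceType} {x n : M → R3} {o : SurfaceOrientation M}
    (hx : IsSurface c x) (hn : IsGaussMap c o x n) (p : M) :
    ∃ e₁ e₂ : Plane, IsFrame c x p e₁ e₂ ∧ 0 < ((o.sign p : ℤ) : ℝ) * planeDet e₁ e₂ ∧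
      n p = c.gaussSign • c.cross ((diff x p : Plane →L[ℝ] R3) e₁)
        ((diff x p : Plane →L[ℝ] R3) e₂) := by
  obtain ⟨h1, h2⟩ := hx.signature p
  obtain ⟨e₁, e₂, h11, h22, h12, hpos⟩ := Kenmotsu.exists_frame (inducedMetric_symm c x p)
    (sign_mul_self o p) c.frameSign_mul_self h1 h2
  exact ⟨e₁, e₂, ⟨h11, h22, h12⟩, hpos, hn p e₁ e₂ ⟨h11, h22, h12⟩ hpos⟩

theorem cross_map (c : SurfaceType) (T : Plane →L[ℝ] R3) (u w : Plane) :
    c.cross (T u) (T w) = planeDet u w • c.cross (T E₀) (T E₁) := by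
  conv_lhs => rw [plane_eq u, plane_eq w]
  simp only [map_add, map_smul]
  ext i
  fin_cases i <;> simp [SurfaceType.cross_apply, planeDet] <;> ring

/-- The Gauss map is the normalized vector product of the coordinate vector fields. -/
theorem gaussMap_eq_of_frame {c : SurfaceType} {T : Plane →L[ℝ] R3} {G : PlaneForm} {n : R3}
    (hGT : ∀ v w, G v w = c.ip (T v) (T w)) {s t : ℝ} (hs : s * s = 1) (ht : t * t = 1)
    {e₁ e₂ u w : Plane} (h11 : G e₁ e₁ = 1) (h22 : G e₂ e₂ = c.frameSign) (h12 : G e₁ e₂ = 0)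
    (hpos : 0 < t * planeDet e₁ e₂) (hn : n = c.gaussSign • c.cross (T e₁) (T e₂))
    (huw : 0 < s * (t * planeDet u w)) :
    n = (c.gaussSign * s / Real.sqrt |gramDet G u w|) • c.cross (T u) (T w) := by
  have hG : ∀ v w, G v w = G w v := fun v w => by rw [hGT, hGT, c.ip_comm]
  have hε := c.frameSign_mul_self
  have hD : planeDet e₁ e₂ ^ 2 * gramDet G E₀ E₁ = c.frameSign := by
    rw [← gramDet_eq hG, gramDet, h11, h22, h12]; ring
  have hδ : 0 < t * planeDet e₁ e₂ := hpos
  have hfac := orientation_factor (s := t) (t := s) (d := planeDet u w) ht hs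
    (by linarith [mul_left_comm s t (planeDet u w)])
  have hd : planeDet u w ≠ 0 := fun h => by simp [h] at huw
  have hda := abs_ne_zero.2 hd
  set δ := planeDet e₁ e₂ with hδdef
  set d := planeDet u w with hddef
  have hδ0 : δ ≠ 0 := fun h => by simp [h] at hδ
  -- The frame has Gram determinant ε, so that of (u, w) is ε (d / δ)²; moreover |δ| = t δ because
  -- the frame is positive.
  have hsq : Real.sqrt |gramDet G u w| = |d| / (t * δ) := by
    have h1 : |gramDet G u w| = (|d| / (t * δ)) ^ 2 := by
      have h2 : gramDet G E₀ E₁ = c.frameSign / δ ^ 2 := by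
        rw [eq_div_iff (pow_ne_zero 2 hδ0)]; linarith
      have h3 : |c.frameSign| = 1 := by
        rcases mul_self_eq_one_iff.1 hε with h | h <;> simp [h]
      rw [gramDet_eq hG, h2, abs_mul, abs_div, h3, abs_pow, abs_pow, sq_abs δ, div_pow, mul_pow,
        show t ^ 2 = 1 by rw [sq, ht]]
      ring
    rw [h1, Real.sqrt_sq (by positivity)]
  rw [hn, cross_map c T e₁ e₂, cross_map c T u w, hsq, smul_smul, smul_smul]
  congr 1
  have ht0 : t ≠ 0 := by rintro rfl; simp at ht
  rw [← mul_div_assoc, div_eq_iff hda] at hfac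
  field_simp
  linear_combination -c.gaussSign * δ * t * hfac - c.gaussSign * δ * |d| * ht

/-- The Gauss map of a surface is smooth. -/
theorem IsGaussMap.contMDiff {c : SurfaceType} {x n : M → R3} {o : SurfaceOrientation M}
    (hx : IsSurface c x) (hn : IsGaussMap c o x n) : ContMDiff (𝓡 2) 𝓘(ℝ, R3) ∞ n := by
  intro p
  obtain ⟨r, hr, hball⟩ := Metric.eventually_nhds_iff_ball.1
    ((eventually_orientation o p).and (extChartAt_target_mem_nhds (I := 𝓡 2) p))
  set B := Metric.ball (extChartAt (𝓡 2) p p) r with hB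
  have hsub : B ⊆ (extChartAt (𝓡 2) p).target := fun y hy => (hball y hy).2
  have hX := (contDiffOn_comp_chart_symm hx.1 p).mono hsub
  have hdX : ContDiffOn ℝ ∞ (localForm (diff x) p) B :=
    ((contDiffOn_infty_iff_fderiv_of_isOpen Metric.isOpen_ball).1 hX).2.congr fun y hy =>
      localForm_diff hx.1 (hsub hy)
  have hdXv : ∀ u, ContDiffOn ℝ ∞ (fun y => localForm (diff x) p y u) B :=
    contDiffOn_clm_apply.1 hdX
  have hC : ∀ u w, ContDiffOn ℝ ∞ (chartCoeff (inducedMetric c x) p u w) B := fun u w =>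
    contDiffOn_ip c (hdXv u) (hdXv w)
  have hG : ContDiffOn ℝ ∞ (chartGram (inducedMetric c x) p) B :=
    ((hC E₀ E₀).mul (hC E₁ E₁)).sub ((hC E₀ E₁).mul (hC E₀ E₁))
  have hGpos : ∀ y ∈ B, 0 < c.frameSign * chartGram (inducedMetric c x) p y := fun y hy => by
    have hd := planeDet_frameMap_ne_zero (hsub hy)
    rw [chartGram, gramDet_eq (inducedMetric_symm c x _), mul_left_comm]
    have := (hx.signature ((extChartAt (𝓡 2) p).symm y)).2
    exact mul_pos (sq_pos_of_ne_zero hd) this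
  have hroot := contDiffOn_sqrt_abs c.frameSign_mul_self hG hGpos
  have hroot0 : ∀ y ∈ B, Real.sqrt |chartGram (inducedMetric c x) p y| ≠ 0 := fun y hy h0 => by
    have h1 := hGpos y hy
    rw [Real.sqrt_eq_zero (abs_nonneg _), abs_eq_zero] at h0
    rw [h0, mul_zero] at h1
    exact h1.false
  have hF := ((contDiffOn_const (c := c.gaussSign * ((o.sign p : ℤ) : ℝ))).div hroot hroot0).smul
    (contDiffOn_cross c (hdXv E₀) (hdXv E₁))
  set F : Plane → R3 := fun y => (c.gaussSign * ((o.sign p : ℤ) : ℝ) /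
    Real.sqrt |chartGram (inducedMetric c x) p y|) •
      c.cross (localForm (diff x) p y E₀) (localForm (diff x) p y E₁) with hFdef
  -- Frames are chosen point by point, without continuity; the normalised product F of coordinate
  -- fields does not depend on the choice and is smooth.
  have hFB : ∀ y ∈ B, n ((extChartAt (𝓡 2) p).symm y) = F y := fun y hy => by
    obtain ⟨e₁, e₂, ⟨h11, h22, h12⟩, hpos, hne⟩ :=
      hx.exists_frame hn ((extChartAt (𝓡 2) p).symm y)
    exact gaussMap_eq_of_frame (T := (diff x ((extChartAt (𝓡 2) p).symm y) : Plane →L[ℝ] R3))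
      (G := (inducedMetric c x ((extChartAt (𝓡 2) p).symm y) : PlaneForm)) (fun _ _ => rfl)
      (sign_mul_self o _) (sign_mul_self o _) h11 h22 h12 hpos hne (hball y hy).1
  have hFs : ContDiffAt ℝ ∞ F (extChartAt (𝓡 2) p p) :=
    hF.contDiffAt (Metric.ball_mem_nhds _ hr)
  have hcomp : ContMDiffAt (𝓡 2) 𝓘(ℝ, R3) ∞ (F ∘ extChartAt (𝓡 2) p) p :=
    hFs.contMDiffAt.comp p contMDiffAt_extChartAt
  refine hcomp.congr_of_eventuallyEq ?_
  filter_upwards [(continuousAt_extChartAt (I := 𝓡 2) p).eventually (Metric.ball_mem_nhds _ hr),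
    extChartAt_source_mem_nhds (I := 𝓡 2) p] with z hz hzs
  have := hFB _ hz
  rwa [(extChartAt (𝓡 2) p).left_inv hzs] at this

theorem IsGaussMap.ip_self {c : SurfaceType} {x n : M → R3} {o : SurfaceOrientation M}
    (hx : IsSurface c x) (hn : IsGaussMap c o x n) (p : M) : c.ip (n p) (n p) = c.normalSign := by
  obtain ⟨e₁, e₂, ⟨h11, h22, h12⟩, -, hne⟩ := hx.exists_frame hn p
  exact (c.frame_relations h11 h22 h12 hne).1

theorem IsGaussMap.ip_diff {c : SurfaceType} {x n : M → R3} {o : SurfaceOrientation M}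
    (hx : IsSurface c x) (hn : IsGaussMap c o x n) (p : M) (v : Plane) :
    c.ip ((diff x p : Plane →L[ℝ] R3) v) (n p) = 0 := by
  obtain ⟨e₁, e₂, ⟨h11, h22, h12⟩, hpos, hne⟩ := hx.exists_frame hn p
  obtain ⟨-, h1, h2, -⟩ := c.frame_relations h11 h22 h12 hne
  have hd : planeDet e₁ e₂ ≠ 0 := fun h => by simp [h] at hpos
  set T : Plane →L[ℝ] R3 := diff x p with hT
  have h1' : c.ip (T e₁) (n p) = 0 := h1
  have h2' : c.ip (T e₂) (n p) = 0 := h2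
  have h3 : c.ip (T (planeDet e₁ e₂ • v)) (n p) = 0 := by
    rw [planeDet_smul_eq, map_add, map_smul, map_smul, c.ip_add_left, c.ip_smul_left,
      c.ip_smul_left, h1', h2']
    ring
  rw [map_smul, c.ip_smul_left, mul_eq_zero, or_iff_right hd] at h3
  exact h3

/-- The second fundamental form is symmetric. -/
theorem IsGaussMap.secondForm_symm {c : SurfaceType} {x n : M → R3} {o : SurfaceOrientation M}
    (hx : IsSurface c x) (hn : IsGaussMap c o x n) (p : M) (v w : Plane) :
    c.ip ((diff x p : Plane →L[ℝ] R3) v) ((diff n p : Plane →L[ℝ] R3) w) =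
      c.ip ((diff x p : Plane →L[ℝ] R3) w) ((diff n p : Plane →L[ℝ] R3) v) := by
  set y₀ := extChartAt (𝓡 2) p p with hy₀
  set X := x ∘ (extChartAt (𝓡 2) p).symm with hXdef
  set T : Plane →L[ℝ] R3 := diff x p with hT
  set A : Plane →L[ℝ] R3 := diff n p with hA
  have ht := extChartAt_target_mem_nhds (I := 𝓡 2) p
  have hXs : ContDiffAt ℝ ∞ X y₀ := (contDiffOn_comp_chart_symm hx.1 p).contDiffAt ht
  have hN : HasFDerivAt (n ∘ (extChartAt (𝓡 2) p).symm) A y₀ := by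
    have h := hasFDerivAt_comp_chart_symm (η := diff n) (mem_extChartAt_target (I := 𝓡 2) p)
      (by rw [extChartAt_to_inv]; exact hasMFDerivAt_diff (hn.contMDiff hx) p)
    rw [localForm_self] at h
    exact h
  have hX' : fderiv ℝ X y₀ = T := by
    rw [← localForm_diff hx.1 (mem_extChartAt_target (I := 𝓡 2) p), localForm_self]
  have hdd : DifferentiableAt ℝ (fderiv ℝ X) y₀ :=
    (hXs.fderiv_right (m := 1) (by norm_num; exact two_le_infty)).differentiableAt (by simp)
  -- Differentiating ⟨X_u, n⟩ = 0 in the direction z. The second derivative of X is symmetric, which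
  -- makes the remaining term symmetric in u and z.
  have key : ∀ u z : Plane,
      c.ip (fderiv ℝ (fderiv ℝ X) y₀ z u) (n p) + c.ip (T u) (A z) = 0 := fun u z => by
    have hXu : HasFDerivAt (fun y => fderiv ℝ X y u) ((fderiv ℝ (fderiv ℝ X) y₀).flip u) y₀ := by
      simpa using hdd.hasFDerivAt.clm_apply (hasFDerivAt_const u y₀)
    obtain ⟨L, hL, hLv⟩ := hasFDerivAt_ip c hXu hN
    have h0 : L = 0 := by
      refine hL.unique ((hasFDerivAt_const (0 : ℝ) y₀).congr_of_eventuallyEq ?_)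
      filter_upwards [ht] with y hy
      rw [← localForm_diff hx.1 hy]
      exact hn.ip_diff hx _ _
    have h1 := hLv z
    rw [h0, hX', Function.comp_apply, extChartAt_to_inv] at h1
    exact h1.symm
  have hsymm := hXs.isSymmSndFDerivAt (by simpa using two_le_infty) v w
  have k1 := key v w
  have k2 := key w v
  rw [hsymm] at k2
  have k3 : c.ip (T v) (A w) = c.ip (T w) (A v) := by linarith
  exact k3

/-- The representation formula: a surface is recovered from its Gauss map and mean curvature. -/
theorem representation {c : SurfaceType} {x n : M → R3} {o : SurfaceOrientation M} {H : M → ℝ}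
    (hx : IsSurface c x) (hn : IsGaussMap c o x n) (hH : IsMeanCurvature c x n H)
    (hH0 : ∀ p, H p ≠ 0) :
    IsIntegralOf x fun p => -(1 / (2 * H p)) • kenmotsuForm c (inducedMetric c x) o n p := by
  refine isIntegralOf_of_contMDiff hx.1 fun p => ?_
  have hd := hasMFDerivAt_diff hx.1 p
  obtain ⟨e₁, e₂, hfr, hpos, hne⟩ := hx.exists_frame hn p
  have hrep := representation_at (c := c) (G := (inducedMetric c x p : PlaneForm))
    (T := (diff x p : Plane →L[ℝ] R3)) (A := (diff n p : Plane →L[ℝ] R3))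
    (Φ := (kenmotsuForm c (inducedMetric c x) o n p : Plane →L[ℝ] R3)) (n := n p)
    (H := H p) (sign_mul_self o p) (fun _ _ => rfl) hfr.1 hfr.2.1 hfr.2.2 hpos hne
    (ip_diff_self (hasMFDerivAt_diff (hn.contMDiff hx) p) (hn.ip_self hx))
    (hn.secondForm_symm hx p) (hH p e₁ e₂ hfr) (hH0 p)
    (kenmotsuForm_apply o n p (inducedMetric_symm c x p))
  exact hrep ▸ hd

end Direct

/-! ### Part (b): from the data to the surface. -/

section Converse

variable {M : Type*} [TopologicalSpace M] [ChartedSpace Plane M]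

theorem diff_eq_of_isIntegralOf {x : M → R3} {η : OneForm M} (h : IsIntegralOf x η) (p : M) :
    (diff x p : Plane →L[ℝ] R3) = η p :=
  (h.1 p).mfderiv

variable [IsManifold (𝓡 2) ∞ M]
  {c : SurfaceType} {g : BilinField M} {o : SurfaceOrientation M} {n : M → R3} {H : M → ℝ}
  {x : M → R3}

theorem contDiffOn_factor (hH : ContMDiff (𝓡 2) 𝓘(ℝ, ℝ) ∞ H) (hH0 : ∀ p, H p ≠ 0) (p₀ : M) :
    ContDiffOn ℝ ∞ ((fun p => -(1 / (2 * H p))) ∘ (extChartAt (𝓡 2) p₀).symm)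
      (extChartAt (𝓡 2) p₀).target := by
  have h := contDiffOn_comp_chart_symm hH p₀
  exact (contDiffOn_const.div (contDiffOn_const.mul h) fun y _ =>
    mul_ne_zero two_ne_zero (hH0 _)).neg

/-- Existence of the surface with prescribed Gauss map and mean curvature. -/
theorem exists_integral [SimplyConnectedSpace M] (hg : IsMetric c g)
    (hn : ContMDiff (𝓡 2) 𝓘(ℝ, R3) ∞ n) (hH : ContMDiff (𝓡 2) 𝓘(ℝ, ℝ) ∞ H)
    (hH0 : ∀ p, H p ≠ 0) (hcl : IsClosedForm fun p => (1 / H p) • kenmotsuForm c g o n p) :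
    ∃ x : M → R3, IsIntegralOf x fun p => -(1 / (2 * H p)) • kenmotsuForm c g o n p := by
  have hsm := isSmoothNearCentres_kenmotsuForm o hg hn (contDiffOn_factor hH hH0)
  have hcl' : IsClosedForm fun p => -(1 / (2 * H p)) • kenmotsuForm c g o n p := by
    intro p₀ y hy
    -- The form to integrate is the closed form Φ / H times the constant -1/2, which passes through
    -- the exterior derivative.
    have h1 : formInChart (fun p => -(1 / (2 * H p)) • kenmotsuForm c g o n p) p₀ =
        (-(1 / 2 : ℝ)) • formInChart (fun p => (1 / H p) • kenmotsuForm c g o n p) p₀ := by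
      funext z
      ext v i
      have h2 : formInChart (fun p => -(1 / (2 * H p)) • kenmotsuForm c g o n p) p₀ z v i =
        -(1 / (2 * H ((extChartAt (𝓡 2) p₀).symm z))) *
          localForm (kenmotsuForm c g o n) p₀ z (v 0) i := rfl
      have h3 : ((-(1 / 2 : ℝ)) • formInChart (fun p => (1 / H p) • kenmotsuForm c g o n p) p₀)
          z v i = (-(1 / 2 : ℝ)) * (1 / H ((extChartAt (𝓡 2) p₀).symm z) *
          localForm (kenmotsuForm c g o n) p₀ z (v 0) i) := rfl
      rw [h2, h3]
      have := hH0 ((extChartAt (𝓡 2) p₀).symm z)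
      field_simp
    rw [h1, extDeriv_smul, hcl p₀ y hy, smul_zero]
  obtain ⟨x, hx⟩ := exists_primitive hsm hcl'
  exact ⟨x, isIntegralOf_of_contMDiff (contMDiff_of_hasMFDerivAt hsm hx) hx⟩

/-- The conformal factor of the form `dn + n × *dn` at every point. -/
theorem exists_factor (hg : IsMetric c g) (hn : ContMDiff (𝓡 2) 𝓘(ℝ, R3) ∞ n)
    (hnn : ∀ p, c.ip (n p) (n p) = c.normalSign) (o : SurfaceOrientation M) (p : M) :
    ∃ l : ℝ, (∀ v w : Plane, c.ip ((kenmotsuForm c g o n p : Plane →L[ℝ] R3) v)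
        ((kenmotsuForm c g o n p : Plane →L[ℝ] R3) w) = l * (g p : PlaneForm) v w) ∧
      (c.frameSign = 1 → (kenmotsuForm c g o n p : Plane →L[ℝ] R3) ≠ 0 → 0 < l) ∧
      (Function.Injective (kenmotsuForm c g o n p : Plane →L[ℝ] R3) → l ≠ 0) :=
  exists_conformal_factor (sign_mul_self o p) (hg.1 p) (hg.signature p).1 (hg.signature p).2
    (hnn p) (ip_diff_self (hasMFDerivAt_diff hn p) hnn) (kenmotsuForm_apply o n p (hg.1 p))

/-- The induced metric is a multiple of the given one. -/
theorem inducedMetric_eq {l : ℝ} {p : M}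
    (hx : IsIntegralOf x fun p => -(1 / (2 * H p)) • kenmotsuForm c g o n p)
    (hl : ∀ v w : Plane, c.ip ((kenmotsuForm c g o n p : Plane →L[ℝ] R3) v)
        ((kenmotsuForm c g o n p : Plane →L[ℝ] R3) w) = l * (g p : PlaneForm) v w) (v w : Plane) :
    (inducedMetric c x p : PlaneForm) v w =
      (1 / (2 * H p)) ^ 2 * l * (g p : PlaneForm) v w := by
  have h1 : (inducedMetric c x p : PlaneForm) v w =
    c.ip ((diff x p : Plane →L[ℝ] R3) v) ((diff x p : Plane →L[ℝ] R3) w) := rfl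
  have h2 : ∀ u : Plane, (diff x p : Plane →L[ℝ] R3) u =
      -(1 / (2 * H p)) • (kenmotsuForm c g o n p : Plane →L[ℝ] R3) u := fun u => by
    rw [diff_eq_of_isIntegralOf hx p]; rfl
  rw [h1, h2, h2, c.ip_smul_left, c.ip_smul_right, hl]
  ring

/-- The sign of the conformal factor is locally constant. -/
theorem eventually_factor_pos {l : M → ℝ} (hg : IsMetric c g)
    (hxs : ContMDiff (𝓡 2) 𝓘(ℝ, R3) ∞ x)
    (hl : ∀ p, ∀ v w : Plane, (inducedMetric c x p : PlaneForm) v w =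
      l p * (g p : PlaneForm) v w) {s : ℝ} {p : M} (hp : 0 < s * l p) :
    ∀ᶠ q in 𝓝 p, 0 < s * l q := by
  -- Along the coordinate field extending v, g stays positive near p, so the sign of l is that of
  -- the induced metric on this field, a continuous function.
  obtain ⟨⟨v, hv⟩, -⟩ := hg.signature p
  set y₀ := extChartAt (𝓡 2) p p with hy₀
  have ht := extChartAt_target_mem_nhds (I := 𝓡 2) p
  have hc1 : ContinuousAt (chartCoeff g p v v) y₀ :=
    ((hg.2.1 p v v).contDiffAt ht).continuousAt
  have hX := contDiffOn_comp_chart_symm hxs p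
  have hdX : ContDiffOn ℝ ∞ (localForm (diff x) p) (extChartAt (𝓡 2) p).target :=
    ((contDiffOn_infty_iff_fderiv_of_isOpen (isOpen_extChartAt_target p)).1 hX).2.congr
      fun y hy => localForm_diff hxs hy
  have hc2 : ContinuousAt (chartCoeff (inducedMetric c x) p v v) y₀ := by
    have h := contDiffOn_clm_apply.1 hdX v
    exact ((contDiffOn_ip c h h).contDiffAt ht).continuousAt
  have hval : ∀ g' : BilinField M, chartCoeff g' p v v y₀ = (g' p : PlaneForm) v v := fun g' => by
    have h1 : chartCoeff g' p v v y₀ = (g' ((extChartAt (𝓡 2) p).symm y₀) : PlaneForm)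
      (frameMap p y₀ v) (frameMap p y₀ v) := rfl
    have h2 : (g' ((extChartAt (𝓡 2) p).symm y₀) : PlaneForm) = g' p := by
      rw [hy₀, extChartAt_to_inv]
    rw [h1, h2, frameMap_self]
    rfl
  have e1 : ∀ᶠ y in 𝓝 y₀, 0 < chartCoeff g p v v y :=
    hc1.eventually (lt_mem_nhds (by rw [hval]; exact hv))
  have e2 : ∀ᶠ y in 𝓝 y₀, 0 < s * chartCoeff (inducedMetric c x) p v v y := by
    have hc3 : ContinuousAt (fun y => s * chartCoeff (inducedMetric c x) p v v y) y₀ :=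
      continuousAt_const.mul hc2
    refine hc3.eventually (lt_mem_nhds ?_)
    change 0 < s * chartCoeff (inducedMetric c x) p v v y₀
    rw [hval, hl, ← mul_assoc]
    exact mul_pos hp hv
  filter_upwards [(continuousAt_extChartAt (I := 𝓡 2) p).eventually (e1.and e2),
    extChartAt_source_mem_nhds (I := 𝓡 2) p] with q hq hqs
  obtain ⟨h1, h2⟩ := hq
  have h3 : chartCoeff (inducedMetric c x) p v v (extChartAt (𝓡 2) p q) =
      l ((extChartAt (𝓡 2) p).symm (extChartAt (𝓡 2) p q)) *
        chartCoeff g p v v (extChartAt (𝓡 2) p q) := hl _ _ _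
  rw [h3, (extChartAt (𝓡 2) p).left_inv hqs, ← mul_assoc] at h2
  exact pos_of_mul_pos_left h2 h1.le

/-- On a connected surface the conformal factor has constant sign. -/
theorem factor_sign [PreconnectedSpace M] {l : M → ℝ} (hg : IsMetric c g)
    (hxs : ContMDiff (𝓡 2) 𝓘(ℝ, R3) ∞ x)
    (hl : ∀ p, ∀ v w : Plane, (inducedMetric c x p : PlaneForm) v w =
      l p * (g p : PlaneForm) v w) (h0 : ∀ p, l p ≠ 0) : (∀ p, 0 < l p) ∨ ∀ p, l p < 0 := by
  have hopen : IsOpen {p | 0 < l p} := isOpen_iff_mem_nhds.2 fun p hp => by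
    have := eventually_factor_pos (s := 1) (p := p) hg hxs hl (by simpa using hp)
    filter_upwards [this] with q hq
    simpa using hq
  have hclosed : IsClosed {p | 0 < l p} := by
    rw [← isOpen_compl_iff]
    refine isOpen_iff_mem_nhds.2 fun p hp => ?_
    have hp' : l p < 0 := lt_of_le_of_ne (not_lt.1 hp) (h0 p)
    have := eventually_factor_pos (s := -1) (p := p) hg hxs hl (by linarith)
    filter_upwards [this] with q hq
    simp only [Set.mem_compl_iff, Set.mem_ofPred_eq, not_lt]
    linarith
  rcases isClopen_iff.1 ⟨hclosed, hopen⟩ with h | h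
  · refine Or.inr fun p => lt_of_le_of_ne (not_lt.1 fun hp => ?_) (h0 p)
    exact (h ▸ hp : p ∈ (∅ : Set M))
  · exact Or.inl fun p => (h ▸ Set.mem_univ p : p ∈ {p | 0 < l p})

/-- The converse of the representation formula. -/
theorem converse [PreconnectedSpace M] (hg : IsMetric c g)
    (hn : ContMDiff (𝓡 2) 𝓘(ℝ, R3) ∞ n) (hnn : ∀ p, c.ip (n p) (n p) = c.normalSign)
    (hH : ContMDiff (𝓡 2) 𝓘(ℝ, ℝ) ∞ H) (hH0 : ∀ p, H p ≠ 0)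
    (hnd : IsNondegenerate c (kenmotsuForm c g o n))
    (hx : IsIntegralOf x fun p => -(1 / (2 * H p)) • kenmotsuForm c g o n p) :
    IsSurface c x ∧ IsMeanCurvature c x n H ∧
      (IsGaussMap c o x n ∨ (c = .timelike ∧ IsGaussMap c (-o) x n)) := by
  have hsm := isSmoothNearCentres_kenmotsuForm o hg hn (contDiffOn_factor hH hH0)
  have hxs := contMDiff_of_hasMFDerivAt hsm hx.1
  choose l hl hlpos hlinj using exists_factor hg hn hnn o
  have hr : ∀ p, 0 < (1 / (2 * H p)) ^ 2 := fun p => by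
    have := hH0 p
    positivity
  have hind := fun p => inducedMetric_eq hx (hl p)
  have hAn := fun p => ip_diff_self (hasMFDerivAt_diff hn p) hnn
  have hΦ := fun p => kenmotsuForm_apply (c := c) o n p (hg.1 p)
  have hframe := fun (p : M) (e₁ e₂ : Plane) (h : IsFrame c x p e₁ e₂) =>
    exists_sign_of_frame (T := (diff x p : Plane →L[ℝ] R3)) (r := -(1 / (2 * H p)))
      (sign_mul_self o p) (hg.1 p) (hnn p) (hAn p) (hΦ p) (hl p)
      (diff_eq_of_isIntegralOf hx p) h.1 h.2.1 h.2.2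
  have hTn : ∀ (p : M) (v : Plane), c.ip ((diff x p : Plane →L[ℝ] R3) v) (n p) = 0 :=
    fun p v => by
      have h2 : (diff x p : Plane →L[ℝ] R3) v =
          -(1 / (2 * H p)) • (kenmotsuForm c g o n p : Plane →L[ℝ] R3) v := by
        rw [diff_eq_of_isIntegralOf hx p]; rfl
      rw [h2, c.ip_smul_left]
      exact mul_eq_zero_of_right _ (kenmotsu_normal (hAn p) (hΦ p) v)
  have hmean : IsMeanCurvature c x n H := fun p e₁ e₂ hfr => by
    obtain ⟨σ, -, -, -, hsum⟩ := hframe p e₁ e₂ hfr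
    have halg : ∀ a b ε h : ℝ, h ≠ 0 → -(1 / (2 * h)) * (a + ε * b) = 1 →
        h = (-a + ε * -b) / 2 := fun a b ε h h0 hab => by
      field_simp at hab
      linarith
    exact halg _ _ _ _ (hH0 p) hsum
  -- The orientation that makes n the Gauss map is the given one corrected by the sign of l: then σ
  -- = 1, so T e₂ = n × T e₁, and `eq_gaussSign_smul_cross` applies.
  have hgauss : ∀ (o' : SurfaceOrientation M),
      (∀ p, 0 < ((o'.sign p : ℤ) : ℝ) * (((o.sign p : ℤ) : ℝ) * l p)) → IsGaussMap c o' x n :=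
    fun o' ho p e₁ e₂ hfr hpos => by
      obtain ⟨σ, -, hσ, hT2, -⟩ := hframe p e₁ e₂ hfr
      have h1 : 0 < ((o.sign p : ℤ) : ℝ) * planeDet e₁ e₂ * l p := by
        have h2 := mul_pos (ho p) hpos
        have h3 : ((o'.sign p : ℤ) : ℝ) * (((o.sign p : ℤ) : ℝ) * l p) *
            (((o'.sign p : ℤ) : ℝ) * planeDet e₁ e₂) =
            ((o.sign p : ℤ) : ℝ) * planeDet e₁ e₂ * l p := by
          linear_combination ((o.sign p : ℤ) : ℝ) * planeDet e₁ e₂ * l p * sign_mul_self o' p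
        exact h3 ▸ h2
      rw [hσ h1, one_smul] at hT2
      have h4 := c.eq_gaussSign_smul_cross hfr.1 (hTn p e₁)
      exact h4.trans (congrArg (fun z => c.gaussSign •
        c.cross ((diff x p : Plane →L[ℝ] R3) e₁) z) hT2.symm)
  have hinjT : ∀ p, Function.Injective (kenmotsuForm c g o n p : Plane →L[ℝ] R3) →
      Function.Injective (diff x p) := fun p h v w hvw => by
    apply h
    have h2 : ∀ u : Plane, (diff x p : Plane →L[ℝ] R3) u =
        -(1 / (2 * H p)) • (kenmotsuForm c g o n p : Plane →L[ℝ] R3) u := fun u => by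
      rw [diff_eq_of_isIntegralOf hx p]; rfl
    have h3 := (h2 v).symm.trans (hvw.trans (h2 w))
    have h4 : -(1 / (2 * H p)) ≠ 0 := fun h0 => by
      have := hr p
      rw [neg_eq_zero] at h0
      rw [h0] at this
      simp at this
    exact smul_right_injective R3 h4 h3
  -- A kernel vector v of Φ would satisfy l g(v, v) = 0.
  have hinjpos : ∀ p, PosDefAt g p → 0 < l p →
      Function.Injective (kenmotsuForm c g o n p : Plane →L[ℝ] R3) := fun p hpd hlp => by
    rw [injective_iff_map_eq_zero]
    intro v hv
    by_contra hv0
    have h1 := hl p v v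
    rw [hv] at h1
    have h2 : 0 < l p * (g p : PlaneForm) v v := mul_pos hlp (hpd v hv0)
    rw [← h1] at h2
    simp [SurfaceType.ip] at h2
  have hsign : ∀ p, 0 < l p → 0 < ((o.sign p : ℤ) : ℝ) * (((o.sign p : ℤ) : ℝ) * l p) :=
    fun p hp => by rw [← mul_assoc, sign_mul_self, one_mul]; exact hp
  cases c
  · have hlp : ∀ p, 0 < l p := fun p => hlpos p rfl (hnd p)
    exact ⟨⟨hxs, fun p => hinjT p (hinjpos p (hg.2.2 p) (hlp p)), trivial⟩, hmean,
      Or.inl (hgauss o fun p => hsign p (hlp p))⟩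
  · have hlp : ∀ p, 0 < l p := fun p => hlpos p rfl (hnd p)
    refine ⟨⟨hxs, fun p => hinjT p (hinjpos p (hg.2.2 p) (hlp p)), fun p v hv => ?_⟩, hmean,
      Or.inl (hgauss o fun p => hsign p (hlp p))⟩
    have h1 := hind p v v
    exact h1 ▸ mul_pos (mul_pos (hr p) (hlp p)) (hg.2.2 p v hv)
  · have hl0 : ∀ p, l p ≠ 0 := fun p => hlinj p (hnd p)
    refine ⟨⟨hxs, fun p => hinjT p (hnd p), fun p => ?_⟩, hmean, ?_⟩
    · obtain ⟨⟨v, hv⟩, ⟨w, hw⟩⟩ := hg.2.2 p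
      have h1 : (inducedMetric .timelike x p : PlaneForm) v v = _ := hind p v v
      have h2 : (inducedMetric .timelike x p : PlaneForm) w w = _ := hind p w w
      -- For l < 0 the vectors v and w exchange their causal types.
      rcases lt_or_gt_of_ne (hl0 p) with hneg | hpos
      · have hm := mul_neg_of_pos_of_neg (hr p) hneg
        exact ⟨⟨w, h2 ▸ mul_pos_of_neg_of_neg hm hw⟩, ⟨v, h1 ▸ mul_neg_of_neg_of_pos hm hv⟩⟩
      · have hm := mul_pos (hr p) hpos
        exact ⟨⟨v, h1 ▸ mul_pos hm hv⟩, ⟨w, h2 ▸ mul_neg_of_pos_of_neg hm hw⟩⟩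
    -- The sign of l is the same everywhere, so one of o and -o serves at all points at once.
    · rcases factor_sign hg hxs hind fun p => mul_ne_zero (hr p).ne' (hl0 p) with h | h
      · exact Or.inl (hgauss o fun p => hsign p (pos_of_mul_pos_right (h p) (hr p).le))
      · refine Or.inr ⟨rfl, hgauss (-o) fun p => ?_⟩
        have hlp : l p < 0 := by
          by_contra hge
          exact absurd (h p) (not_lt.2 (mul_nonneg (hr p).le (not_lt.1 hge)))
        have h1 : (((-o).sign p : ℤ) : ℝ) = -((o.sign p : ℤ) : ℝ) := by
          have : (-o).sign p = -o.sign p := rfl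
          rw [this]; simp
        rw [h1]
        have h2 := sign_mul_self o p
        have h3 : -((o.sign p : ℤ) : ℝ) * (((o.sign p : ℤ) : ℝ) * l p) = -l p := by
          linear_combination -(l p) * h2
        rw [h3]
        linarith

end Converse

end Kenmotsu

end

open Kenmotsu in
theorem theorem2p1 {M : Type*} [TopologicalSpace M] [T2Space M] [SecondCountableTopology M]
    [ChartedSpace (EuclideanSpace ℝ (Fin 2)) M] [IsManifold (𝓡 2) ∞ M]
    (c : SurfaceType) (o : SurfaceOrientation M) :
    (ConnectedSpace M →
      ∀ (x n : M → Fin 3 → ℝ) (H : M → ℝ),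
        IsSurface c x → IsGaussMap c o x n → IsMeanCurvature c x n H → (∀ p, H p ≠ 0) →
        IsIntegralOf x fun p => -(1 / (2 * H p)) • kenmotsuForm c (inducedMetric c x) o n p) ∧
    (SimplyConnectedSpace M →
      ∀ (g : BilinField M) (n : M → Fin 3 → ℝ) (H : M → ℝ),
        IsMetric c g →
        ContMDiff (𝓡 2) 𝓘(ℝ, Fin 3 → ℝ) ∞ n → (∀ p, c.ip (n p) (n p) = c.normalSign) →
        ContMDiff (𝓡 2) 𝓘(ℝ, ℝ) ∞ H → (∀ p, H p ≠ 0) →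
        IsClosedForm (fun p => (1 / H p) • kenmotsuForm c g o n p) →
        (∃ x : M → Fin 3 → ℝ,
          IsIntegralOf x fun p => -(1 / (2 * H p)) • kenmotsuForm c g o n p) ∧
        (IsNondegenerate c (kenmotsuForm c g o n) → ∀ x : M → Fin 3 → ℝ,
          (IsIntegralOf x fun p => -(1 / (2 * H p)) • kenmotsuForm c g o n p) →
          IsSurface c x ∧ IsMeanCurvature c x n H ∧
            (IsGaussMap c o x n ∨ (c = .timelike ∧ IsGaussMap c (-o) x n)))) := by
  refine ⟨fun _ x n H hx hn hH hH0 => representation hx hn hH hH0,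
    fun _ g n H hg hn hnn hH hH0 hcl => ⟨exists_integral hg hn hH hH0 hcl, fun hnd x hx => ?_⟩⟩
  exact converse hg hn hnn hH hH0 hnd hx
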